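/- Let $R>0$, $p\in(2,\infty]$, and let $b\in L^p_{\rm loc}([0,\infty);\,r\,dr)$ be a real-valued non-negative function vanishing (almost everywhere) outside the interval $(0,R)$. Put $B(x)=b(|x|)$ for $x\in\mathbb{R}^2$, suppose that $\int_{\mathbb{R}^2}B\,dx>0$, and let $$\alpha=\frac1{2\pi}\int_{\mathbb{R}^2}B\,dx,\qquad \mu_\alpha=\min_{m\in\mathbb{Z}}|m-\alpha|,\qquad \lambda(R)=\int_0^R b(t)\,t\log t\,dt,$$ $$h(x)=-\frac1{2\pi}\int_{\mathbb{R}^2}B(y)\log|x-y|\,dy,\qquad A_h=(\partial_{x_2}h,\,-\partial_{x_1}h),\qquad Q_+[u]=\int_{\mathbb{R}^2}\big(|(i\nabla+A_h)u|^2+B|u|^2\big)\,dx .$$ Let $g_+(r)=1$ for $0\le r\le R$ and $g_+(r)=R^{-\alpha}r^{\alpha}$ for $r>R$, and set $$\beta_+(B;R)=\left(\frac{\inf_{x\in\mathbb{R}^2}e^{-h(x)}/g_+(|x|)}{\sup_{x\in\mathbb{R}^2}e^{-h(x)}/g_+(|x|)}\right)^2 .$$ Then $h$ is differentiable on $\mathbb{R}^2$,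 $$\beta_+(B;R)=\frac{e^{2\lambda(R)}}{R^{2\alpha}},$$ and for every complex-valued $u\in H^1(\mathbb{R}^2)$ the integral defining $Q_+[u]$ converges absolutely and $$Q_+[u]\ \ge\ \mu_\alpha^2\,\frac{e^{2\lambda(R)}}{R^{2\alpha}}\int_{\mathbb{R}^2}\frac{|u|^2}{R^2+|x|^2}\,dx .$$ -/

import Mathlib

open MeasureTheory
open scoped ENNReal ContDiff

noncomputable section

namespace PauliHardy

/-- The Euclidean plane `ℝ²`, with the Euclidean norm and Lebesgue measure. -/
abbrev Plane : Type := EuclideanSpace ℝ (Fin 2)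

/-- The partial derivative in the direction of the `j`-th coordinate of a real function. -/
def partialDeriv (j : Fin 2) (f : Plane → ℝ) (x : Plane) : ℝ :=
  fderiv ℝ f x (EuclideanSpace.single j (1 : ℝ))

/-- `g = (g 0, g 1)` is the weak (distributional) gradient of the function `u`. -/
def HasWeakGradient (u : Plane → ℂ) (g : Fin 2 → Plane → ℂ) : Prop :=
  ∀ (j : Fin 2) (φ : Plane → ℝ), ContDiff ℝ ∞ φ → HasCompactSupport φ →
    ∫ x, partialDeriv j φ x • u x = -∫ x, φ x • g j x

/-- `g` is a square integrable weak gradient of `u`. -/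
def HasL2WeakGradient (u : Plane → ℂ) (g : Fin 2 → Plane → ℂ) : Prop :=
  (∀ j, MemLp (g j) 2 volume) ∧ HasWeakGradient u g

/-- Membership in the Sobolev space `H¹(ℝ²)` of complex valued functions. -/
def MemH1 (u : Plane → ℂ) : Prop :=
  MemLp u 2 volume ∧ ∃ g, HasL2WeakGradient u g

open Classical in
/-- The weak gradient of a function in `H¹(ℝ²)` (unique up to null sets; zero by convention
for functions without a square integrable weak gradient). -/
def weakGradient (u : Plane → ℂ) : Fin 2 → Plane → ℂ :=
  if hu : ∃ g, HasL2WeakGradient u g then Classical.choose hu else 0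

/-- The normalized flux `α = (2π)⁻¹ ∫ B` of a magnetic field `B`. -/
def flux (B : Plane → ℝ) : ℝ := 1 / (2 * Real.pi) * ∫ x, B x

/-- The scalar potential `h(x) = -(2π)⁻¹ ∫ B(y) log |x - y| dy`. -/
def scalarPotential (B : Plane → ℝ) (x : Plane) : ℝ :=
  -(1 / (2 * Real.pi)) * ∫ y, B y * Real.log ‖x - y‖

/-- The vector potential `A_h = (∂₂ h, -∂₁ h)`. -/
def vectorPotential (B : Plane → ℝ) (x : Plane) : Plane :=
  !₂[partialDeriv 1 (scalarPotential B) x, -partialDeriv 0 (scalarPotential B) x]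

/-- The density `|(i∇ + A_h) u|² + B |u|²` of the quadratic form `Q₊`. -/
def pauliDensity (B : Plane → ℝ) (u : Plane → ℂ) (x : Plane) : ℝ :=
  (∑ j : Fin 2, ‖Complex.I * weakGradient u j x + (vectorPotential B x j : ℂ) * u x‖ ^ 2)
    + B x * ‖u x‖ ^ 2

/-- The quadratic form `Q₊[u] = ∫ (|(i∇ + A_h) u|² + B |u|²) dx`. -/
def pauliForm (B : Plane → ℝ) (u : Plane → ℂ) : ℝ := ∫ x, pauliDensity B u x

/-- The distance `μ_α` from `α` to the set of integers. -/
def distInt (α : ℝ) : ℝ := ⨅ m : ℤ, |(m : ℝ) - α|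

/-- The comparison function `g₊(ρ; r)`: it is `1` for `r ≤ ρ` and `ρ^(-α) r^α` for `r > ρ`. -/
def gPlus (α ρ r : ℝ) : ℝ := if r ≤ ρ then 1 else ρ ^ (-α) * r ^ α

/-- `k₊(ρ) = inf e^(-h(x)) / g₊(ρ; |x|)` over the plane. -/
def kPlus (B : Plane → ℝ) (ρ : ℝ) : ℝ :=
  ⨅ x : Plane, Real.exp (-scalarPotential B x) / gPlus (flux B) ρ ‖x‖

/-- `K₊(ρ) = sup e^(-h(x)) / g₊(ρ; |x|)` over the plane. -/
def capKPlus (B : Plane → ℝ) (ρ : ℝ) : ℝ :=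
  ⨆ x : Plane, Real.exp (-scalarPotential B x) / gPlus (flux B) ρ ‖x‖

/-- `β₊(B; ρ) = (k₊(ρ) / K₊(ρ))²`. -/
def betaPlus (B : Plane → ℝ) (ρ : ℝ) : ℝ := (kPlus B ρ / capKPlus B ρ) ^ 2

/-- `b ∈ L^p_loc(ℝ₊; r dr)`, where `ℝ₊ = [0, ∞)`: integrability up to the origin. -/
def MemLpLocRadial (b : ℝ → ℝ) (p : ℝ≥0∞) : Prop :=
  ∀ T : ℝ, 0 < T →
    MemLp b p ((volume.restrict (Set.Ioc 0 T)).withDensity (fun r => ENNReal.ofReal r))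

/-- The radial field `B(x) = b(|x|)`. -/
def radialField (b : ℝ → ℝ) (x : Plane) : ℝ := b ‖x‖

/-- `λ(R) = ∫₀ᴿ b(t) t log t dt`. -/
def logMoment (b : ℝ → ℝ) (R : ℝ) : ℝ := ∫ t in (0 : ℝ)..R, b t * t * Real.log t

end PauliHardy

end

/-!
By Newton's theorem the potential of a radial field is radial, `h(x) = η(|x|)`, where `η' = -Φ(r)/r`
and `Φ(r) = ∫₀ʳ b(t) t dt`. It is antitone, equals `-λ(R)` at the origin and `-α log r` for `r ≥ R`,
so that `β₊ = w(R)` with `w(r) = exp (2 (η(r) - η(0)))`.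

For a test function, integrate `B |u|²` by parts in the radius and call `J(r)` the expectation of
the angular momentum on the circle of radius `r`. Completing a square in two ways bounds the energy
on that circle below: by `-J'(r)` alone, or by terms in `|u|²` and its radial derivative. For
`r ≥ R` the Poincaré inequality `μ_α² ∫ |u|² ≤ ∫ |(-i ∂_θ - α) u|²` replaces the second bound.
These are averaged with the weights `1 - w` and `w`, where `w` is frozen at `β₊` beyond `R`; as
`w' = -2 (Φ/r) w`, all but multiples of `|u|²` is then an exact derivative. The contributions of the
two regions on the circle `r = R` add up to `β₊ (α - μ_α²) ∫ |u|²`, which is nonnegative because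
`μ_α ≤ 1/2` and `μ_α ≤ α`.

The inequality passes to `H¹` because test functions are dense there: an element `a` of `H¹`
orthogonal to all of them solves `Δ a = a`, which has no square integrable solution but zero.
-/

namespace PauliHardy

open Set Filter Topology Real

lemma ae_norm_of_ae_pos {E : Type*} [NormedAddCommGroup E] [NormedSpace ℝ E]
    [FiniteDimensional ℝ E] [Nontrivial E] [MeasurableSpace E] [BorelSpace E] (μ : Measure E)
    [μ.IsAddHaarMeasure] {P : ℝ → Prop} (h : ∀ᵐ r : ℝ, 0 < r → P r) : ∀ᵐ x ∂μ, P ‖x‖ := by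
  have hIoi : ∀ᵐ r : Ioi (0 : ℝ) ∂Measure.comap Subtype.val volume, P r := by
    rw [← ae_restrict_iff_subtype measurableSet_Ioi, ae_restrict_iff' measurableSet_Ioi]
    exact h
  have hprod : ∀ᵐ p ∂μ.toSphere.prod (.volumeIoiPow (Module.finrank ℝ E - 1)), P p.2 :=
    Measure.quasiMeasurePreserving_snd.ae (withDensity_absolutelyContinuous _ _ hIoi)
  have hcomap : ∀ᵐ x : ({0}ᶜ : Set E) ∂μ.comap (↑), P ‖(x : E)‖ := by
    simpa using μ.measurePreserving_homeomorphUnitSphereProd.quasiMeasurePreserving.ae hprod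
  rwa [← ae_restrict_iff_subtype (p := fun x => P ‖x‖) (measurableSet_singleton _).compl,
    restrict_compl_singleton] at hcomap

/-- A Borel radial field profile, nonnegative, supported in `(0, R)` and square integrable with
respect to `r dr`: the Borel representative of an almost everywhere class. -/
structure IsRadialProfile (b : ℝ → ℝ) (R : ℝ) : Prop where
  pos : 0 < R
  measurable : Measurable b
  nonneg : ∀ r, 0 ≤ b r
  eq_zero : ∀ r, r ∉ Ioo 0 R → b r = 0
  integrable_sq : Integrable fun r => b r ^ 2 * r

/-- The normalized flux `Φ(r) = ∫₀ʳ b(t) t dt` through the disc of radius `r`. -/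
noncomputable def radialFlux (b : ℝ → ℝ) (r : ℝ) : ℝ := ∫ t in (0 : ℝ)..r, b t * t

/-- The angular component `a(r) = Φ(r) / r` of the vector potential. The value `0` which division
gives at `r = 0` is the correct one, by `IsRadialProfile.continuous_angularPotential`. -/
noncomputable def angularPotential (b : ℝ → ℝ) (r : ℝ) : ℝ := radialFlux b r / r

/-- The bound for `|A_h|` which the Cauchy–Schwarz inequality gives. -/
noncomputable def potentialBound (b : ℝ → ℝ) : ℝ := √((∫ t, b t ^ 2 * t) / 2)

/-- The radial profile of the scalar potential, in the form given by Newton's theorem. -/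
noncomputable def radialPotential (b : ℝ → ℝ) (r : ℝ) : ℝ := -∫ t, b t * t * Real.log (max r t)

lemma potentialBound_nonneg (b : ℝ → ℝ) : 0 ≤ potentialBound b := Real.sqrt_nonneg _

lemma angularPotential_mul_self (b : ℝ → ℝ) (r : ℝ) :
    angularPotential b r * r = radialFlux b r := by
  rcases eq_or_ne r 0 with rfl | hr
  · simp [radialFlux]
  · rw [angularPotential, div_mul_cancel₀ _ hr]

lemma abs_log_max_le {r t M : ℝ} (ht : 0 < t) (htM : t ≤ M) (hrM : r ≤ M) :
    |Real.log (max r t)| ≤ |Real.log t| + |Real.log M| :=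
  (abs_le_max_abs_abs (Real.log_le_log ht (le_max_right r t))
    (Real.log_le_log (lt_max_of_lt_right ht) (max_le hrM htM))).trans
    (max_le_add_of_nonneg (abs_nonneg _) (abs_nonneg _))

lemma log_sub_log_le {m x y : ℝ} (hm : 0 < m) (hx : m ≤ x) (hy : m ≤ y) :
    Real.log x - Real.log y ≤ m⁻¹ * |x - y| := by
  have hx₀ : 0 < x := hm.trans_le hx
  have hy₀ : 0 < y := hm.trans_le hy
  calc Real.log x - Real.log y = Real.log (x / y) := (Real.log_div hx₀.ne' hy₀.ne').symm
    _ ≤ x / y - 1 := Real.log_le_sub_one_of_pos (by positivity)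
    _ = y⁻¹ * (x - y) := by field_simp
    _ ≤ y⁻¹ * |x - y| := mul_le_mul_of_nonneg_left (le_abs_self _) (by positivity)
    _ ≤ m⁻¹ * |x - y| := by gcongr

lemma abs_log_sub_log_le {m x y : ℝ} (hm : 0 < m) (hx : m ≤ x) (hy : m ≤ y) :
    |Real.log x - Real.log y| ≤ m⁻¹ * |x - y| := by
  refine abs_sub_le_iff.2 ⟨log_sub_log_le hm hx hy, ?_⟩
  rw [abs_sub_comm]
  exact log_sub_log_le hm hy hx

namespace IsRadialProfile

variable {b : ℝ → ℝ} {R : ℝ}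

lemma mul_id_nonneg (hb : IsRadialProfile b R) (t : ℝ) : 0 ≤ b t * t := by
  by_cases ht : t ∈ Ioo 0 R
  · exact mul_nonneg (hb.nonneg t) ht.1.le
  · simp [hb.eq_zero t ht]

lemma sq_mul_id_nonneg (hb : IsRadialProfile b R) (t : ℝ) : 0 ≤ b t ^ 2 * t := by
  rw [sq, mul_assoc]
  exact mul_nonneg (hb.nonneg t) (hb.mul_id_nonneg t)

lemma eq_zero_of_nonpos (hb : IsRadialProfile b R) {t : ℝ} (ht : t ≤ 0) : b t = 0 :=
  hb.eq_zero t fun h => absurd h.1 (not_lt.2 ht)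

lemma eq_zero_of_ge (hb : IsRadialProfile b R) {t : ℝ} (ht : R ≤ t) : b t = 0 :=
  hb.eq_zero t fun h => absurd h.2 (not_lt.2 ht)

lemma measurable_mul_id (hb : IsRadialProfile b R) : Measurable fun t => b t * t :=
  hb.measurable.mul measurable_id

lemma integral_congr (hb : IsRadialProfile b R) {f g : ℝ → ℝ} (h : EqOn f g (Ioo 0 R)) :
    ∫ t, b t * t * f t = ∫ t, b t * t * g t := by
  refine integral_congr_ae (ae_of_all _ fun t => ?_)
  by_cases ht : t ∈ Ioo 0 R
  · simp only [h ht]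
  · simp only [hb.eq_zero t ht, zero_mul]

lemma integral_Ioi (hb : IsRadialProfile b R) (f : ℝ → ℝ) :
    ∫ t in Ioi 0, b t * t * f t = ∫ t, b t * t * f t :=
  setIntegral_eq_integral_of_forall_compl_eq_zero fun t ht => by
    simp [hb.eq_zero_of_nonpos (not_lt.1 ht)]

lemma integrable_mul_id (hb : IsRadialProfile b R) : Integrable fun t => b t * t := by
  have hconst : Integrable ((Ioo 0 R).indicator fun _ : ℝ => R) :=
    (integrable_indicator_iff measurableSet_Ioo).2 (integrableOn_const (by simp))
  refine (hb.integrable_sq.add hconst).mono' hb.measurable_mul_id.aestronglyMeasurable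
    (ae_of_all _ fun t => ?_)
  rw [Real.norm_of_nonneg (hb.mul_id_nonneg t)]
  by_cases ht : t ∈ Ioo 0 R
  · simp only [Pi.add_apply, indicator_of_mem ht]
    nlinarith [ht.1, ht.2, mul_nonneg (sq_nonneg (b t - 1)) ht.1.le, hb.mul_id_nonneg t]
  · simp [hb.eq_zero t ht, indicator_of_notMem ht]

lemma integrable_mul_abs_log (hb : IsRadialProfile b R) :
    Integrable fun t => b t * t * |Real.log t| := by
  have hlog : Integrable ((Ioo 0 R).indicator fun t : ℝ => (2 * (√t * Real.log √t)) ^ 2) := by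
    refine (integrable_indicator_iff measurableSet_Ioo).2 (IntegrableOn.mono_set
      (Continuous.integrableOn_Icc ?_) Ioo_subset_Icc_self)
    exact (continuous_const.mul (Real.continuous_mul_log.comp Real.continuous_sqrt)).pow 2
  refine (hb.integrable_sq.add hlog).mono'
    (hb.measurable_mul_id.mul Real.measurable_log.norm).aestronglyMeasurable
    (ae_of_all _ fun t => ?_)
  rw [Real.norm_of_nonneg (mul_nonneg (hb.mul_id_nonneg t) (abs_nonneg _))]
  by_cases ht : t ∈ Ioo 0 R
  · have hsq : (2 * (√t * (Real.log t / 2))) ^ 2 = t * |Real.log t| ^ 2 := by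
      rw [sq_abs]
      linear_combination (Real.log t) ^ 2 * Real.sq_sqrt ht.1.le
    simp only [Pi.add_apply, indicator_of_mem ht, Real.log_sqrt ht.1.le, hsq]
    nlinarith [mul_nonneg (sq_nonneg (b t - |Real.log t|)) ht.1.le,
      mul_nonneg (sq_nonneg (b t + |Real.log t|)) ht.1.le]
  · simp [hb.eq_zero t ht, indicator_of_notMem ht]

lemma norm_mul_log_max_le (hb : IsRadialProfile b R) {r M : ℝ} (hrM : r ≤ M) (hRM : R ≤ M)
    (t : ℝ) : ‖b t * t * Real.log (max r t)‖ ≤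
      b t * t * |Real.log t| + b t * t * |Real.log M| := by
  rw [norm_mul, Real.norm_of_nonneg (hb.mul_id_nonneg t), Real.norm_eq_abs, ← mul_add]
  by_cases ht : t ∈ Ioo 0 R
  · exact mul_le_mul_of_nonneg_left (abs_log_max_le ht.1 (ht.2.le.trans hRM) hrM)
      (hb.mul_id_nonneg t)
  · simp [hb.eq_zero t ht]

lemma integrable_mul_abs_log_add (hb : IsRadialProfile b R) (c : ℝ) :
    Integrable fun t => b t * t * |Real.log t| + b t * t * c :=
  hb.integrable_mul_abs_log.add (hb.integrable_mul_id.mul_const c)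

lemma measurable_mul_log_max (hb : IsRadialProfile b R) (r : ℝ) :
    Measurable fun t => b t * t * Real.log (max r t) :=
  hb.measurable_mul_id.mul (measurable_const.max measurable_id).log

lemma integrable_mul_log_max (hb : IsRadialProfile b R) (r : ℝ) :
    Integrable fun t => b t * t * Real.log (max r t) :=
  (hb.integrable_mul_abs_log_add _).mono' (hb.measurable_mul_log_max r).aestronglyMeasurable
    (ae_of_all _ (hb.norm_mul_log_max_le (le_max_left r R) (le_max_right r R)))

lemma radialFlux_of_nonpos (hb : IsRadialProfile b R) {r : ℝ} (hr : r ≤ 0) :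
    radialFlux b r = 0 := by
  rw [radialFlux, intervalIntegral.integral_congr (g := fun _ => 0) fun t ht => ?_]
  · simp
  · rw [uIcc_of_ge hr] at ht
    simp [hb.eq_zero_of_nonpos ht.2]

lemma radialFlux_eq_setIntegral (hb : IsRadialProfile b R) (r : ℝ) :
    radialFlux b r = ∫ t in Iic r, b t * t := by
  rw [radialFlux, ← intervalIntegral.integral_Iic_sub_Iic hb.integrable_mul_id.integrableOn
    hb.integrable_mul_id.integrableOn, setIntegral_congr_fun (s := Iic 0) (g := fun _ => 0)
      measurableSet_Iic fun t ht => by simp [hb.eq_zero_of_nonpos ht]]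
  simp

lemma radialFlux_of_ge (hb : IsRadialProfile b R) {r : ℝ} (hr : R ≤ r) :
    radialFlux b r = ∫ t, b t * t := by
  rw [hb.radialFlux_eq_setIntegral]
  refine setIntegral_eq_integral_of_forall_compl_eq_zero fun t ht => ?_
  simp [hb.eq_zero_of_ge (hr.trans (not_le.1 ht).le)]

lemma radialFlux_nonneg (hb : IsRadialProfile b R) (r : ℝ) : 0 ≤ radialFlux b r := by
  rw [hb.radialFlux_eq_setIntegral]
  exact integral_nonneg fun t => hb.mul_id_nonneg t

lemma continuous_radialFlux (hb : IsRadialProfile b R) : Continuous (radialFlux b) :=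
  intervalIntegral.continuous_primitive (fun _ _ => hb.integrable_mul_id.intervalIntegrable) 0

lemma angularPotential_of_nonpos (hb : IsRadialProfile b R) {r : ℝ} (hr : r ≤ 0) :
    angularPotential b r = 0 := by
  rw [angularPotential, hb.radialFlux_of_nonpos hr, zero_div]

lemma angularPotential_nonneg (hb : IsRadialProfile b R) (r : ℝ) : 0 ≤ angularPotential b r := by
  rcases le_total r 0 with hr | hr
  · exact (hb.angularPotential_of_nonpos hr).ge
  · exact div_nonneg (hb.radialFlux_nonneg r) hr

lemma angularPotential_sq_le (hb : IsRadialProfile b R) {r : ℝ} (hr : 0 < r) :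
    angularPotential b r ^ 2 ≤ (∫ t in (0 : ℝ)..r, b t ^ 2 * t) / 2 := by
  -- The square is completed with `k` twice the mean of `b` over the disc of radius `r`.
  set k := 2 * radialFlux b r / r ^ 2 with hk
  have hsq := hb.integrable_sq.intervalIntegrable (a := 0) (b := r)
  have hmul := (hb.integrable_mul_id.const_mul (2 * k)).intervalIntegrable (a := 0) (b := r)
  have hid : IntervalIntegrable (fun t : ℝ => k ^ 2 * t) volume 0 r :=
    (continuous_const.mul continuous_id).intervalIntegrable _ _
  have hnonneg : 0 ≤ ∫ t in (0 : ℝ)..r, (b t ^ 2 * t - 2 * k * (b t * t) + k ^ 2 * t) :=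
    intervalIntegral.integral_nonneg hr.le fun t ht => by
      nlinarith [mul_nonneg (sq_nonneg (b t - k)) ht.1]
  rw [intervalIntegral.integral_add (hsq.sub hmul) hid, intervalIntegral.integral_sub hsq hmul,
    intervalIntegral.integral_const_mul, intervalIntegral.integral_const_mul,
    integral_id] at hnonneg
  have hsum : 2 * k * radialFlux b r - k ^ 2 * ((r ^ 2 - 0 ^ 2) / 2) =
      2 * angularPotential b r ^ 2 := by
    rw [hk, angularPotential]
    field_simp
    ring
  rw [radialFlux] at hsum
  linarith

lemma angularPotential_le_potentialBound (hb : IsRadialProfile b R) (r : ℝ) :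
    angularPotential b r ≤ potentialBound b := by
  rcases le_or_gt r 0 with hr | hr
  · exact (hb.angularPotential_of_nonpos hr).trans_le (potentialBound_nonneg b)
  · refine Real.le_sqrt_of_sq_le ((hb.angularPotential_sq_le hr).trans ?_)
    rw [intervalIntegral.integral_of_le hr.le]
    exact div_le_div_of_nonneg_right
      (setIntegral_le_integral hb.integrable_sq (ae_of_all _ hb.sq_mul_id_nonneg)) two_pos.le

lemma continuous_angularPotential (hb : IsRadialProfile b R) :
    Continuous (angularPotential b) := by
  refine continuous_iff_continuousAt.2 fun r => ?_
  rcases ne_or_eq r 0 with hr | rfl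
  · exact hb.continuous_radialFlux.continuousAt.div continuousAt_id hr
  · have hlim : Tendsto (fun r : ℝ => √(|∫ t in (0 : ℝ)..r, b t ^ 2 * t| / 2)) (𝓝 0) (𝓝 0) := by
      have hE : Continuous fun r : ℝ => ∫ t in (0 : ℝ)..r, b t ^ 2 * t :=
        intervalIntegral.continuous_primitive (fun _ _ => hb.integrable_sq.intervalIntegrable) 0
      simpa using (hE.abs.div_const 2).sqrt.tendsto 0
    rw [ContinuousAt, hb.angularPotential_of_nonpos le_rfl]
    refine squeeze_zero hb.angularPotential_nonneg (fun r => ?_) hlim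
    rcases le_or_gt r 0 with hr | hr
    · exact (hb.angularPotential_of_nonpos hr).trans_le (Real.sqrt_nonneg _)
    · refine Real.le_sqrt_of_sq_le ((hb.angularPotential_sq_le hr).trans ?_)
      gcongr
      exact le_abs_self _

lemma hasDerivAt_mul_log_max (b : ℝ → ℝ) {r t : ℝ} (hr : 0 < r) (ht : t ≠ r) :
    HasDerivAt (fun s => b t * t * Real.log (max s t))
      ((Iic r).indicator (fun t => b t * t) t / r) r := by
  rcases ht.lt_or_gt with h | h
  · rw [indicator_of_mem (mem_Iic.2 h.le), div_eq_mul_inv]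
    refine ((Real.hasDerivAt_log hr.ne').const_mul _).congr_of_eventuallyEq ?_
    filter_upwards [Ioi_mem_nhds h] with s hs
    rw [max_eq_left (le_of_lt hs)]
  · rw [indicator_of_notMem (by simpa using h), zero_div]
    refine (hasDerivAt_const r (b t * t * Real.log t)).congr_of_eventuallyEq ?_
    filter_upwards [Iio_mem_nhds h] with s hs
    rw [max_eq_right (le_of_lt hs)]

lemma hasDerivAt_radialPotential_of_pos (hb : IsRadialProfile b R) {r : ℝ} (hr : 0 < r) :
    HasDerivAt (radialPotential b) (-angularPotential b r) r := by
  have hlip (t : ℝ) : LipschitzOnWith (Real.nnabs (b t * t * (r / 2)⁻¹))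
      (fun s => b t * t * Real.log (max s t)) (Ioi (r / 2)) := by
    refine LipschitzOnWith.of_dist_le_mul fun x hx y hy => ?_
    have hlog := abs_log_sub_log_le (half_pos hr) (le_max_of_le_left (c := t) (le_of_lt hx))
      (le_max_of_le_left (c := t) (le_of_lt hy))
    have hmax : (r / 2)⁻¹ * |max x t - max y t| ≤ (r / 2)⁻¹ * |x - y| :=
      mul_le_mul_of_nonneg_left (abs_max_sub_max_le_abs x y t) (by positivity)
    rw [Real.dist_eq, Real.dist_eq, ← mul_sub, abs_mul, Real.coe_nnabs, abs_mul (b t * t),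
      abs_of_pos (inv_pos.2 (half_pos hr)), mul_assoc]
    exact mul_le_mul_of_nonneg_left (hlog.trans hmax) (abs_nonneg _)
  have hderiv := (hasDerivAt_integral_of_dominated_loc_of_lip (𝕜 := ℝ)
    (Ioi_mem_nhds (half_lt_self hr))
    (Eventually.of_forall fun s => (hb.measurable_mul_log_max s).aestronglyMeasurable)
    (hb.integrable_mul_log_max r)
    ((hb.measurable_mul_id.indicator measurableSet_Iic).div_const r).aestronglyMeasurable
    (ae_of_all _ hlip) (hb.integrable_mul_id.mul_const _)
    ((Measure.ae_ne volume r).mono fun t ht => hasDerivAt_mul_log_max b hr ht)).2.neg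
  rw [integral_div, integral_indicator measurableSet_Iic, ← hb.radialFlux_eq_setIntegral]
    at hderiv
  exact hderiv

lemma radialPotential_of_nonpos (hb : IsRadialProfile b R) {r : ℝ} (hr : r ≤ 0) :
    radialPotential b r = radialPotential b 0 :=
  congrArg Neg.neg <| hb.integral_congr fun t ht => by
    simp only [max_eq_right (hr.trans ht.1.le), max_eq_right ht.1.le]

lemma continuousAt_radialPotential_zero (hb : IsRadialProfile b R) :
    ContinuousAt (radialPotential b) 0 := by
  refine (continuousAt_of_dominated
    (Eventually.of_forall fun s => (hb.measurable_mul_log_max s).aestronglyMeasurable)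
    ?_ (hb.integrable_mul_abs_log_add |Real.log (max 1 R)|) (ae_of_all _ fun t => ?_)).neg
  · filter_upwards [Iio_mem_nhds one_pos] with r hr
    exact ae_of_all _ (hb.norm_mul_log_max_le (le_max_of_le_left (le_of_lt hr))
      (le_max_right 1 R))
  · by_cases ht : t ∈ Ioo 0 R
    · exact continuousAt_const.mul (ContinuousAt.log
        (continuous_id.max continuous_const).continuousAt (lt_max_of_lt_right ht.1).ne')
    · simp only [hb.eq_zero t ht, zero_mul]
      exact continuousAt_const

lemma hasDerivAt_radialPotential (hb : IsRadialProfile b R) (r : ℝ) :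
    HasDerivAt (radialPotential b) (-angularPotential b r) r := by
  refine hasDerivAt_of_hasDerivAt_of_ne' (x := 0) (fun s hs => ?_)
    hb.continuousAt_radialPotential_zero hb.continuous_angularPotential.neg.continuousAt r
  rcases hs.lt_or_gt with h | h
  · rw [Pi.neg_apply, hb.angularPotential_of_nonpos h.le, neg_zero]
    refine (hasDerivAt_const s (radialPotential b 0)).congr_of_eventuallyEq ?_
    filter_upwards [Iio_mem_nhds h] with x hx
    exact hb.radialPotential_of_nonpos (le_of_lt hx)
  · exact hb.hasDerivAt_radialPotential_of_pos h

lemma antitone_radialPotential (hb : IsRadialProfile b R) : Antitone (radialPotential b) :=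
  antitone_of_hasDerivAt_nonpos hb.hasDerivAt_radialPotential
    fun r => neg_nonpos.2 (hb.angularPotential_nonneg r)

lemma radialPotential_zero (hb : IsRadialProfile b R) :
    radialPotential b 0 = -logMoment b R := by
  rw [radialPotential, logMoment, intervalIntegral.integral_of_le hb.pos.le,
    setIntegral_eq_integral_of_forall_compl_eq_zero fun t ht => by
      simp [hb.eq_zero t fun h => ht ⟨h.1, h.2.le⟩]]
  exact congrArg Neg.neg <| hb.integral_congr fun t ht => by rw [max_eq_right ht.1.le]

lemma radialPotential_of_ge (hb : IsRadialProfile b R) {r : ℝ} (hr : R ≤ r) :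
    radialPotential b r = -((∫ t, b t * t) * Real.log r) := by
  rw [radialPotential, ← integral_mul_const]
  exact congrArg Neg.neg <| hb.integral_congr (g := fun _ => Real.log r) fun t ht => by
    simp only [max_eq_left (ht.2.le.trans hr)]

end IsRadialProfile

/-! ### Polar coordinates in the plane -/

/-- The unit vector `e^{iθ}` of the plane at angle `θ`. -/
noncomputable def unitVec (θ : ℝ) : Plane := !₂[Real.cos θ, Real.sin θ]

/-- The rotation of the plane by a quarter turn, which takes `e^{iθ}` to the unit tangent vector
of the circle at angle `θ`. -/
def quarterTurn (x : Plane) : Plane := !₂[-x 1, x 0]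

@[simp] lemma unitVec_apply_zero (θ : ℝ) : unitVec θ 0 = Real.cos θ := rfl

@[simp] lemma unitVec_apply_one (θ : ℝ) : unitVec θ 1 = Real.sin θ := rfl

@[simp] lemma quarterTurn_apply_zero (x : Plane) : quarterTurn x 0 = -x 1 := rfl

@[simp] lemma quarterTurn_apply_one (x : Plane) : quarterTurn x 1 = x 0 := rfl

lemma quarterTurn_smul (r : ℝ) (x : Plane) : quarterTurn (r • x) = r • quarterTurn x := by
  ext i
  fin_cases i <;> simp

lemma norm_quarterTurn (x : Plane) : ‖quarterTurn x‖ = ‖x‖ := by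
  rw [← sq_eq_sq₀ (norm_nonneg _) (norm_nonneg _), EuclideanSpace.norm_sq_eq,
    EuclideanSpace.norm_sq_eq, Fin.sum_univ_two, Fin.sum_univ_two]
  simp [add_comm]

@[simp] lemma norm_unitVec (θ : ℝ) : ‖unitVec θ‖ = 1 := by
  rw [← sq_eq_sq₀ (norm_nonneg _) zero_le_one, EuclideanSpace.norm_sq_eq, Fin.sum_univ_two]
  simp

lemma norm_smul_unitVec {r : ℝ} (hr : 0 ≤ r) (θ : ℝ) : ‖r • unitVec θ‖ = r := by
  rw [norm_smul, norm_unitVec, mul_one, Real.norm_of_nonneg hr]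

lemma unitVec_periodic : Function.Periodic unitVec (2 * π) := fun θ => by simp [unitVec]

lemma contDiff_unitVec : ContDiff ℝ ∞ unitVec := by
  refine contDiff_euclidean.2 fun i => ?_
  fin_cases i
  · exact Real.contDiff_cos
  · exact Real.contDiff_sin

lemma contDiff_polar : ContDiff ℝ ∞ fun p : ℝ × ℝ => p.1 • unitVec p.2 :=
  contDiff_fst.smul (contDiff_unitVec.comp contDiff_snd)

/-- The linear isometry between the complex numbers and the plane. -/
noncomputable def complexEquivPlane : ℂ ≃ₗᵢ[ℝ] Plane := Complex.orthonormalBasisOneI.repr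

lemma complexEquivPlane_apply (z : ℂ) : complexEquivPlane z = !₂[z.re, z.im] := by
  ext i
  simp only [complexEquivPlane, Complex.orthonormalBasisOneI_repr_apply]

lemma complexEquivPlane_polarCoord_symm (p : ℝ × ℝ) :
    complexEquivPlane (Complex.polarCoord.symm p) = p.1 • unitVec p.2 := by
  rw [complexEquivPlane_apply, Complex.polarCoord_symm_apply]
  ext i
  fin_cases i <;> simp [unitVec, -Complex.ofReal_cos, -Complex.ofReal_sin]

lemma complexEquivPlane_circleMap (r θ : ℝ) :
    complexEquivPlane (circleMap 0 r θ) = r • unitVec θ := by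
  rw [complexEquivPlane_apply]
  ext i
  fin_cases i <;> simp [unitVec, circleMap]

lemma measurePreserving_complexEquivPlane : MeasurePreserving complexEquivPlane :=
  Complex.orthonormalBasisOneI.measurePreserving_repr

/-- Lebesgue measure on the domain `(0, ∞) × (-π, π)` of polar coordinates, without the Jacobian
factor `r`. -/
noncomputable def polarMeasure : Measure (ℝ × ℝ) :=
  (volume.restrict (Ioi 0)).prod (volume.restrict (Ioo (-π) π))

lemma polarMeasure_eq :
    polarMeasure = (volume : Measure (ℝ × ℝ)).restrict polarCoord.target := by
  rw [polarMeasure, Measure.prod_restrict]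
  rfl

lemma ae_polarMeasure_pos : ∀ᵐ p ∂polarMeasure, 0 < p.1 := by
  rw [polarMeasure_eq]
  filter_upwards [ae_restrict_mem polarCoord.open_target.measurableSet] with p hp
  exact hp.1

section PolarIntegral

variable {F : Type*} [NormedAddCommGroup F] [NormedSpace ℝ F]

lemma integral_polar (f : Plane → F) :
    ∫ x, f x = ∫ p, p.1 • f (p.1 • unitVec p.2) ∂polarMeasure := by
  rw [← measurePreserving_complexEquivPlane.integral_comp
    complexEquivPlane.toHomeomorph.measurableEmbedding,
    ← Complex.integral_comp_polarCoord_symm, polarMeasure_eq]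
  simp_rw [complexEquivPlane_polarCoord_symm]

lemma lintegral_polar (f : Plane → ℝ≥0∞) :
    ∫⁻ x, f x = ∫⁻ p, ENNReal.ofReal p.1 * f (p.1 • unitVec p.2) ∂polarMeasure := by
  rw [← measurePreserving_complexEquivPlane.lintegral_comp_emb
    complexEquivPlane.toHomeomorph.measurableEmbedding,
    ← Complex.lintegral_comp_polarCoord_symm, polarMeasure_eq]
  simp_rw [complexEquivPlane_polarCoord_symm, smul_eq_mul]

lemma integrable_polar {f : Plane → F} (hm : StronglyMeasurable f) (hf : Integrable f) :
    Integrable (fun p : ℝ × ℝ => p.1 • f (p.1 • unitVec p.2)) polarMeasure := by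
  refine ⟨(measurable_fst.stronglyMeasurable.smul
    (hm.comp_measurable contDiff_polar.continuous.measurable)).aestronglyMeasurable, ?_⟩
  have hfin := hf.hasFiniteIntegral
  rw [hasFiniteIntegral_iff_enorm, lintegral_polar] at hfin
  rw [hasFiniteIntegral_iff_enorm]
  convert hfin using 1
  refine lintegral_congr_ae ?_
  filter_upwards [ae_polarMeasure_pos] with p hp
  rw [enorm_smul, Real.enorm_eq_ofReal hp.le]

lemma integral_Ioo_neg_pi_pi (f : ℝ → F) :
    ∫ θ in Ioo (-π) π, f θ = ∫ θ in (-π)..π, f θ := by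
  rw [intervalIntegral.integral_of_le (neg_le_self pi_nonneg), integral_Ioc_eq_integral_Ioo]

lemma integral_polar_iterated {f : Plane → F} (hm : StronglyMeasurable f) (hf : Integrable f) :
    ∫ x, f x = ∫ r in Ioi (0 : ℝ), r • ∫ θ in (-π)..π, f (r • unitVec θ) := by
  rw [integral_polar, polarMeasure, integral_prod _ (integrable_polar hm hf)]
  simp only [integral_smul, integral_Ioo_neg_pi_pi]

end PolarIntegral

/-! ### Newton's theorem for radial fields -/

lemma norm_sub_smul_unitVec (x : Plane) (r θ : ℝ) :
    ‖x - r • unitVec θ‖ = ‖circleMap 0 r θ - complexEquivPlane.symm x‖ := by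
  rw [← complexEquivPlane.norm_map, map_sub, LinearIsometryEquiv.apply_symm_apply,
    complexEquivPlane_circleMap, norm_sub_rev]

lemma periodic_log_norm_sub_smul_unitVec (x : Plane) (r : ℝ) :
    Function.Periodic (fun θ => Real.log ‖x - r • unitVec θ‖) (2 * π) := fun θ => by
  simp only [unitVec_periodic θ]

lemma integrableOn_log_norm_sub_smul_unitVec (x : Plane) (r : ℝ) :
    IntegrableOn (fun θ => Real.log ‖x - r • unitVec θ‖) (Ioo (-π) π) := by
  have hcircle := circleIntegrable_log_norm_sub_const (a := complexEquivPlane.symm x) (c := 0) r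
  refine IntegrableOn.mono_set (t := Ioc (-π) π) ?_ Ioo_subset_Ioc_self
  refine ((periodic_log_norm_sub_smul_unitVec x r).intervalIntegrable (t := 0) (by positivity)
    ?_ (-π) π).1
  simpa only [zero_add, norm_sub_smul_unitVec, CircleIntegrable] using hcircle

lemma integral_log_norm_sub_smul_unitVec (x : Plane) {r : ℝ} (hr : 0 < r) :
    ∫ θ in Ioo (-π) π, Real.log ‖x - r • unitVec θ‖ = 2 * π * Real.log (max ‖x‖ r) := by
  have hmean := circleAverage_log_norm_sub_const_eq_log_radius_add_posLog
    (a := complexEquivPlane.symm x) (c := 0) hr.ne'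
  have hshift := (periodic_log_norm_sub_smul_unitVec x r).intervalIntegral_add_eq 0 (-π)
  have hmax : Real.log r + Real.posLog (r⁻¹ * ‖x‖) = Real.log (max ‖x‖ r) := by
    rw [Real.posLog_eq_log_max_one (by positivity), ← Real.log_mul hr.ne' (by positivity),
      mul_max_of_nonneg _ _ hr.le, mul_one, mul_inv_cancel_left₀ hr.ne', max_comm]
  rw [Real.circleAverage, zero_sub, norm_neg, LinearIsometryEquiv.norm_map, smul_eq_mul,
    hmax] at hmean
  simp_rw [← norm_sub_smul_unitVec] at hmean
  rw [zero_add, show -π + 2 * π = π by ring] at hshift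
  rw [integral_Ioo_neg_pi_pi, ← hshift, ← hmean]
  field_simp

lemma integral_abs_log_norm_sub_smul_unitVec_le {x : Plane} {r M : ℝ} (hr : 0 < r)
    (hM : r + ‖x‖ ≤ M) :
    ∫ θ in Ioo (-π) π, |Real.log ‖x - r • unitVec θ‖| ≤
      2 * π * (2 * Real.posLog M - Real.log (max ‖x‖ r)) := by
  have hint := integrableOn_log_norm_sub_smul_unitVec x r
  have hle (θ : ℝ) : |Real.log ‖x - r • unitVec θ‖| ≤
      2 * Real.posLog M - Real.log ‖x - r • unitVec θ‖ := by
    have hnorm : ‖x - r • unitVec θ‖ ≤ M := (norm_sub_le _ _).trans (by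
      rw [norm_smul_unitVec hr.le]
      linarith)
    have hpos : Real.log ‖x - r • unitVec θ‖ ≤ Real.posLog M :=
      (le_max_right _ _).trans (Real.posLog_le_posLog (norm_nonneg _) hnorm)
    exact abs_le.2 ⟨by linarith [Real.posLog_nonneg (x := M)], by linarith⟩
  calc ∫ θ in Ioo (-π) π, |Real.log ‖x - r • unitVec θ‖|
      ≤ ∫ θ in Ioo (-π) π, (2 * Real.posLog M - Real.log ‖x - r • unitVec θ‖) :=
        integral_mono hint.abs ((integrable_const _).sub hint) hle
    _ = _ := by
        rw [integral_sub (integrable_const _) hint, integral_log_norm_sub_smul_unitVec x hr,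
          integral_Ioo_neg_pi_pi, intervalIntegral.integral_const, smul_eq_mul]
        ring

namespace IsRadialProfile

variable {b : ℝ → ℝ} {R : ℝ}

lemma measurable_radialField (hb : IsRadialProfile b R) : Measurable (radialField b) :=
  hb.measurable.comp measurable_norm

lemma integrable_radialField (hb : IsRadialProfile b R) : Integrable (radialField b) := by
  refine (integrable_fun_norm_addHaar (volume : Measure Plane) (f := b)).2 ?_
  refine hb.integrable_mul_id.integrableOn.congr_fun (fun r _ => ?_) measurableSet_Ioi
  simp [mul_comm]

lemma flux_radialField (hb : IsRadialProfile b R) :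
    flux (radialField b) = ∫ t, b t * t := by
  have hpolar : ∫ x, radialField b x = 2 * (π * ∫ t, b t * t) := by
    have hball : volume.real (Metric.ball (0 : Plane) 1) = π := by
      simp [Measure.real, pi_nonneg]
    have hIoi : ∫ t in Ioi 0, t * b t = ∫ t, b t * t := by
      simpa only [mul_one, mul_comm] using hb.integral_Ioi fun _ => 1
    have hnorm := integral_fun_norm_addHaar (volume : Measure Plane) b
    rw [hball] at hnorm
    simpa [radialField, hIoi] using hnorm
  rw [flux, hpolar]
  field_simp

lemma integrable_mul_log_polar (hb : IsRadialProfile b R) (x : Plane) :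
    Integrable (fun p : ℝ × ℝ => b p.1 * p.1 * Real.log ‖x - p.1 • unitVec p.2‖)
      polarMeasure := by
  have hm : Measurable fun p : ℝ × ℝ => b p.1 * p.1 * Real.log ‖x - p.1 • unitVec p.2‖ :=
    (hb.measurable_mul_id.comp measurable_fst).mul
      (continuous_const.sub contDiff_polar.continuous).norm.measurable.log
  have hbound : Integrable fun r => 2 * π * (b r * r * (2 * Real.posLog (R + ‖x‖)) -
      b r * r * Real.log (max ‖x‖ r)) :=
    ((hb.integrable_mul_id.mul_const _).sub (hb.integrable_mul_log_max ‖x‖)).const_mul _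
  rw [polarMeasure, integrable_prod_iff hm.aestronglyMeasurable]
  refine ⟨ae_of_all _ fun r => (integrableOn_log_norm_sub_smul_unitVec x r).const_mul (b r * r),
    hbound.integrableOn.mono' hm.aestronglyMeasurable.norm.integral_prod_right'
      (ae_of_all _ fun r => ?_)⟩
  rw [Real.norm_of_nonneg (integral_nonneg fun _ => norm_nonneg _)]
  simp_rw [norm_mul (b r * r), Real.norm_of_nonneg (hb.mul_id_nonneg r), integral_const_mul,
    Real.norm_eq_abs]
  by_cases hr : r ∈ Ioo 0 R
  · refine (mul_le_mul_of_nonneg_left (integral_abs_log_norm_sub_smul_unitVec_le hr.1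
      (add_le_add_left hr.2.le ‖x‖)) (hb.mul_id_nonneg r)).trans_eq ?_
    ring
  · simp [hb.eq_zero r hr]

theorem scalarPotential_radialField (hb : IsRadialProfile b R) (x : Plane) :
    scalarPotential (radialField b) x = radialPotential b ‖x‖ := by
  have hpolar : ∫ y, radialField b y * Real.log ‖x - y‖ =
      ∫ p, b p.1 * p.1 * Real.log ‖x - p.1 • unitVec p.2‖ ∂polarMeasure := by
    rw [integral_polar]
    refine integral_congr_ae ?_
    filter_upwards [ae_polarMeasure_pos] with p hp
    rw [radialField, norm_smul_unitVec hp.le, smul_eq_mul]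
    ring
  have hangular : EqOn
      (fun r => ∫ θ in Ioo (-π) π, b r * r * Real.log ‖x - r • unitVec θ‖)
      (fun r => 2 * π * (b r * r * Real.log (max ‖x‖ r))) (Ioi 0) := fun r hr => by
    simp only [integral_const_mul, integral_log_norm_sub_smul_unitVec x hr]
    ring
  rw [scalarPotential, radialPotential, hpolar, polarMeasure,
    integral_prod _ (hb.integrable_mul_log_polar x),
    setIntegral_congr_fun measurableSet_Ioi hangular, integral_const_mul, hb.integral_Ioi]
  field_simp

end IsRadialProfile

/-! ### The potentials of a radial field -/

lemma hasFDerivAt_comp_norm {E : Type*} [NormedAddCommGroup E] [InnerProductSpace ℝ E]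
    {f : ℝ → ℝ} {f' : ℝ} {x : E} (hf : HasDerivAt f f' ‖x‖) (hf' : x = 0 → f' = 0) :
    HasFDerivAt (fun y => f ‖y‖) ((f' / ‖x‖) • innerSL ℝ x) x := by
  rcases eq_or_ne x 0 with rfl | hx
  · rw [hf' rfl, norm_zero, hasDerivAt_iff_isLittleO_nhds_zero] at hf
    simp only [zero_add, smul_zero, sub_zero] at hf
    have hnorm : Tendsto (fun y : E => ‖y‖) (𝓝 0) (𝓝 0) := tendsto_norm_zero
    refine hasFDerivAt_iff_isLittleO_nhds_zero.2 ?_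
    simpa [Function.comp_def] using (hf.comp_tendsto hnorm).of_norm_right
  · have hx' : ‖x‖ ≠ 0 := norm_ne_zero_iff.2 hx
    have hnorm := (hasStrictFDerivAt_norm_sq x).hasFDerivAt.sqrt (by positivity)
    simp only [Real.sqrt_sq (norm_nonneg _)] at hnorm
    refine (hf.comp_hasFDerivAt x hnorm).congr_fderiv ?_
    ext y
    simp only [one_div, mul_inv_rev, smul_apply, coe_innerSL_apply, nsmul_eq_mul, Nat.cast_ofNat,
      smul_eq_mul]
    field_simp

namespace IsRadialProfile

variable {b : ℝ → ℝ} {R : ℝ}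

lemma hasFDerivAt_scalarPotential (hb : IsRadialProfile b R) (x : Plane) :
    HasFDerivAt (scalarPotential (radialField b))
      ((-angularPotential b ‖x‖ / ‖x‖) • innerSL ℝ x) x := by
  rw [funext hb.scalarPotential_radialField]
  refine hasFDerivAt_comp_norm (hb.hasDerivAt_radialPotential ‖x‖) fun hx => ?_
  rw [hx, norm_zero, hb.angularPotential_of_nonpos le_rfl, neg_zero]

lemma partialDeriv_scalarPotential (hb : IsRadialProfile b R) (j : Fin 2) (x : Plane) :
    partialDeriv j (scalarPotential (radialField b)) x =
      -angularPotential b ‖x‖ / ‖x‖ * x j := by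
  rw [partialDeriv, (hb.hasFDerivAt_scalarPotential x).fderiv]
  simp [EuclideanSpace.inner_single_right]

lemma vectorPotential_radialField (hb : IsRadialProfile b R) (x : Plane) :
    vectorPotential (radialField b) x = (angularPotential b ‖x‖ / ‖x‖) • quarterTurn x := by
  ext i
  fin_cases i <;> simp [vectorPotential, hb.partialDeriv_scalarPotential, neg_div]

lemma vectorPotential_smul_unitVec (hb : IsRadialProfile b R) {r : ℝ} (hr : 0 < r) (θ : ℝ) :
    vectorPotential (radialField b) (r • unitVec θ) =
      angularPotential b r • quarterTurn (unitVec θ) := by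
  rw [hb.vectorPotential_radialField, norm_smul_unitVec hr.le, quarterTurn_smul, smul_smul,
    div_mul_cancel₀ _ hr.ne']

lemma norm_vectorPotential (hb : IsRadialProfile b R) (x : Plane) :
    ‖vectorPotential (radialField b) x‖ = angularPotential b ‖x‖ := by
  rw [hb.vectorPotential_radialField, norm_smul, norm_quarterTurn,
    Real.norm_of_nonneg (div_nonneg (hb.angularPotential_nonneg _) (norm_nonneg x))]
  rcases eq_or_ne x 0 with rfl | hx
  · simp [hb.angularPotential_of_nonpos le_rfl]
  · exact div_mul_cancel₀ _ (norm_ne_zero_iff.2 hx)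

lemma abs_vectorPotential_le (hb : IsRadialProfile b R) (x : Plane) (j : Fin 2) :
    |vectorPotential (radialField b) x j| ≤ potentialBound b :=
  (PiLp.norm_apply_le _ j).trans ((hb.norm_vectorPotential x).trans_le
    (hb.angularPotential_le_potentialBound _))

lemma measurable_vectorPotential (hb : IsRadialProfile b R) (j : Fin 2) :
    Measurable fun x => vectorPotential (radialField b) x j := by
  have ha : Measurable fun x : Plane => angularPotential b ‖x‖ / ‖x‖ :=
    (hb.continuous_angularPotential.measurable.comp measurable_norm).div measurable_norm
  have hturn : Measurable fun x : Plane => quarterTurn x j := by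
    fin_cases j
    · exact (EuclideanSpace.proj (1 : Fin 2)).continuous.neg.measurable
    · exact (EuclideanSpace.proj (0 : Fin 2)).continuous.measurable
  simp only [hb.vectorPotential_radialField, PiLp.smul_apply, smul_eq_mul]
  exact ha.mul hturn

/-! ### The constant `β₊` -/

lemma exp_neg_radialPotential_of_ge (hb : IsRadialProfile b R) {r : ℝ} (hr : R ≤ r) :
    Real.exp (-radialPotential b r) = r ^ flux (radialField b) := by
  rw [hb.radialPotential_of_ge hr, neg_neg, hb.flux_radialField,
    Real.rpow_def_of_pos (hb.pos.trans_le hr), mul_comm]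

lemma exp_neg_radialPotential_zero (hb : IsRadialProfile b R) :
    Real.exp (-radialPotential b 0) = Real.exp (logMoment b R) := by
  rw [hb.radialPotential_zero, neg_neg]

lemma monotone_exp_neg_radialPotential (hb : IsRadialProfile b R) :
    Monotone fun r => Real.exp (-radialPotential b r) :=
  fun _ _ h => Real.exp_le_exp.2 (neg_le_neg (hb.antitone_radialPotential h))

lemma exp_neg_scalarPotential_div_gPlus (hb : IsRadialProfile b R) (x : Plane) :
    Real.exp (-scalarPotential (radialField b) x) / gPlus (flux (radialField b)) R ‖x‖ =
      Real.exp (-radialPotential b (min ‖x‖ R)) := by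
  rw [hb.scalarPotential_radialField, gPlus]
  split_ifs with h
  · rw [div_one, min_eq_left h]
  · have hx : R < ‖x‖ := not_le.1 h
    have hpow := Real.rpow_pos_of_pos (hb.pos.trans hx) (flux (radialField b))
    rw [min_eq_right hx.le, hb.exp_neg_radialPotential_of_ge hx.le,
      hb.exp_neg_radialPotential_of_ge le_rfl, Real.rpow_neg hb.pos.le]
    field_simp

lemma kPlus_radialField (hb : IsRadialProfile b R) :
    kPlus (radialField b) R = Real.exp (logMoment b R) := by
  simp only [kPlus, hb.exp_neg_scalarPotential_div_gPlus]
  refine IsLeast.csInf_eq ⟨⟨0, ?_⟩, ?_⟩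
  · simp [hb.pos.le, hb.exp_neg_radialPotential_zero]
  · rintro _ ⟨x, rfl⟩
    rw [← hb.exp_neg_radialPotential_zero]
    exact hb.monotone_exp_neg_radialPotential (le_min (norm_nonneg x) hb.pos.le)

lemma capKPlus_radialField (hb : IsRadialProfile b R) :
    capKPlus (radialField b) R = R ^ flux (radialField b) := by
  simp only [capKPlus, hb.exp_neg_scalarPotential_div_gPlus]
  refine IsGreatest.csSup_eq ⟨⟨R • unitVec 0, ?_⟩, ?_⟩
  · simp [norm_smul_unitVec hb.pos.le, hb.exp_neg_radialPotential_of_ge le_rfl]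
  · rintro _ ⟨x, rfl⟩
    rw [← hb.exp_neg_radialPotential_of_ge le_rfl]
    exact hb.monotone_exp_neg_radialPotential (min_le_right _ _)

theorem betaPlus_radialField (hb : IsRadialProfile b R) :
    betaPlus (radialField b) R =
      Real.exp (2 * logMoment b R) / R ^ (2 * flux (radialField b)) := by
  rw [betaPlus, hb.kPlus_radialField, hb.capKPlus_radialField, div_pow, ← Real.exp_nat_mul,
    ← Real.rpow_mul_natCast hb.pos.le, mul_comm (flux _)]
  norm_cast

end IsRadialProfile

/-! ### The Poincaré inequality on the circle -/

lemma distInt_nonneg (α : ℝ) : 0 ≤ distInt α := Real.iInf_nonneg fun _ => abs_nonneg _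

lemma distInt_le (α : ℝ) (m : ℤ) : distInt α ≤ |(m : ℝ) - α| :=
  ciInf_le ⟨0, by rintro _ ⟨n, rfl⟩; exact abs_nonneg _⟩ m

lemma distInt_sq_le (α : ℝ) (m : ℤ) : distInt α ^ 2 ≤ ((m : ℝ) - α) ^ 2 :=
  (pow_le_pow_left₀ (distInt_nonneg α) (distInt_le α m) 2).trans_eq (sq_abs _)

lemma distInt_le_half (α : ℝ) : distInt α ≤ 1 / 2 :=
  (distInt_le α (round α)).trans (by rw [abs_sub_comm]; exact abs_sub_round α)

lemma neg_pi_lt_pi : -π < π := neg_lt_self pi_pos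

lemma fourierCoeffOn_deriv {f f' : ℝ → ℂ} (hf : ∀ θ, HasDerivAt f (f' θ) θ)
    (hf' : Continuous f') (hper : f π = f (-π)) (n : ℤ) :
    fourierCoeffOn neg_pi_lt_pi f' n = Complex.I * n * fourierCoeffOn neg_pi_lt_pi f n := by
  rcases eq_or_ne n 0 with rfl | hn
  · have hzero : ∫ θ in (-π)..π, f' θ = 0 := by
      rw [intervalIntegral.integral_eq_sub_of_hasDerivAt (fun θ _ => hf θ)
        (hf'.intervalIntegrable _ _), hper, sub_self]
    simp [fourierCoeffOn_eq_integral, hzero]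
  · rw [fourierCoeffOn_of_hasDerivAt neg_pi_lt_pi hn (fun θ _ => hf θ)
      (hf'.intervalIntegrable _ _), hper]
    have hπ : (π : ℂ) ≠ 0 := by exact_mod_cast pi_ne_zero
    have hn' : (n : ℂ) ≠ 0 := by exact_mod_cast hn
    push_cast
    field_simp
    ring

lemma fourierCoeffOn_twisted_deriv {f f' : ℝ → ℂ} (hf : ∀ θ, HasDerivAt f (f' θ) θ)
    (hf' : Continuous f') (hper : f π = f (-π)) (α : ℝ) (n : ℤ) :
    fourierCoeffOn neg_pi_lt_pi (fun θ => -Complex.I * f' θ - α * f θ) n =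
      (n - α) * fourierCoeffOn neg_pi_lt_pi f n := by
  have hc : Continuous f := continuous_iff_continuousAt.2 fun θ => (hf θ).continuousAt
  have hlin : fourierCoeffOn neg_pi_lt_pi (fun θ => -Complex.I * f' θ - α * f θ) n =
      -Complex.I * fourierCoeffOn neg_pi_lt_pi f' n - α * fourierCoeffOn neg_pi_lt_pi f n := by
    have hint (g : ℝ → ℂ) (hg : Continuous g) : IntervalIntegrable
        (fun θ : ℝ => (fourier (-n) (θ : AddCircle (π - -π)) : ℂ) * g θ) volume (-π) π :=
      (((fourier (-n)).continuous.comp (AddCircle.continuous_mk' _)).mul hg).intervalIntegrable _ _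
    simp only [fourierCoeffOn_eq_integral, smul_eq_mul, Complex.real_smul]
    rw [mul_left_comm, mul_left_comm (α : ℂ), ← mul_sub,
      ← intervalIntegral.integral_const_mul (-Complex.I),
      ← intervalIntegral.integral_const_mul (α : ℂ), ← intervalIntegral.integral_sub
        ((hint f' hf').const_mul _) ((hint f hc).const_mul _)]
    congr 1
    exact intervalIntegral.integral_congr fun θ _ => by ring
  rw [hlin, fourierCoeffOn_deriv hf hf' hper n]
  linear_combination (-n * fourierCoeffOn neg_pi_lt_pi f n) * Complex.I_sq

lemma distInt_sq_mul_integral_le {f f' : ℝ → ℂ} (hf : ∀ θ, HasDerivAt f (f' θ) θ)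
    (hf' : Continuous f') (hper : f π = f (-π)) (α : ℝ) :
    distInt α ^ 2 * ∫ θ in (-π)..π, ‖f θ‖ ^ 2 ≤
      ∫ θ in (-π)..π, ‖-Complex.I * f' θ - α * f θ‖ ^ 2 := by
  have hc : Continuous f := continuous_iff_continuousAt.2 fun θ => (hf θ).continuousAt
  have hL2 (g : ℝ → ℂ) (hg : Continuous g) : MemLp g 2 (volume.restrict (Ioc (-π) π)) :=
    (memLp_two_iff_integrable_sq_norm hg.aestronglyMeasurable).2
      ((hg.norm.pow 2).integrableOn_Icc.mono_set Ioc_subset_Icc_self)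
  have hparseval := (hasSum_sq_fourierCoeffOn neg_pi_lt_pi (hL2 f hc)).mul_left (distInt α ^ 2)
  have hparseval' := hasSum_sq_fourierCoeffOn neg_pi_lt_pi
    (hL2 (fun θ => -Complex.I * f' θ - α * f θ) (by fun_prop))
  have hle := hasSum_le (fun n => ?_) hparseval hparseval'
  · rw [smul_eq_mul, smul_eq_mul, mul_left_comm] at hle
    exact le_of_mul_le_mul_left hle (inv_pos.2 (by linarith [pi_pos]))
  · rw [fourierCoeffOn_twisted_deriv hf hf' hper, norm_mul, mul_pow]
    refine mul_le_mul_of_nonneg_right ?_ (sq_nonneg _)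
    have hreal : ((n : ℂ) - α) = ((n - α : ℝ) : ℂ) := by push_cast; rfl
    rw [hreal, Complex.norm_real, Real.norm_eq_abs, sq_abs]
    exact distInt_sq_le α n

/-! ### The `L²` pairing on the circle -/

lemma hasDerivAt_intervalIntegral_of_continuous {E : Type*} [NormedAddCommGroup E]
    [NormedSpace ℝ E] {F F' : ℝ → ℝ → E} {c d : ℝ}
    (hF : ∀ r θ, HasDerivAt (fun s => F s θ) (F' r θ) r) (hFc : ∀ r, Continuous (F r))
    (hF' : Continuous (Function.uncurry F')) (r : ℝ) :
    HasDerivAt (fun s => ∫ θ in c..d, F s θ) (∫ θ in c..d, F' r θ) r := by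
  obtain ⟨C, hC⟩ := (isCompact_Icc.prod isCompact_uIcc).exists_bound_of_continuousOn
    (s := Icc (r - 1) (r + 1) ×ˢ uIcc c d) hF'.continuousOn
  refine (intervalIntegral.hasDerivAt_integral_of_dominated_loc_of_deriv_le
    (F := F) (F' := F') (bound := fun _ => C) (s := Icc (r - 1) (r + 1))
    (Icc_mem_nhds (by linarith) (by linarith))
    (Eventually.of_forall fun s => (hFc s).aestronglyMeasurable)
    ((hFc r).intervalIntegrable _ _) ?_ ?_ (by simp) ?_).2
  · exact (hF'.comp (Continuous.prodMk_right r)).aestronglyMeasurable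
  · exact ae_of_all _ fun θ hθ s hs => hC (s, θ) ⟨hs, uIoc_subset_uIcc hθ⟩
  · exact ae_of_all _ fun θ _ s _ => hF s θ

open scoped ComplexConjugate

/-- The inner product of `L²(-π, π)`, conjugate linear in the first argument. -/
noncomputable def circleInner (f g : ℝ → ℂ) : ℂ := ∫ θ in (-π)..π, conj (f θ) * g θ

/-- The squared norm of `L²(-π, π)`. -/
noncomputable def circleNormSq (f : ℝ → ℂ) : ℝ := ∫ θ in (-π)..π, ‖f θ‖ ^ 2

lemma circleInner_self (f : ℝ → ℂ) : circleInner f f = circleNormSq f := by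
  rw [circleInner, circleNormSq, ← intervalIntegral.integral_ofReal]
  exact intervalIntegral.integral_congr fun θ _ => by
    simp only [Complex.conj_mul', Complex.ofReal_pow]

lemma conj_circleInner (f g : ℝ → ℂ) : conj (circleInner f g) = circleInner g f := by
  rw [circleInner, circleInner, intervalIntegral, intervalIntegral, map_sub, ← integral_conj,
    ← integral_conj]
  simp [mul_comm]

lemma circleInner_smul_right (f g : ℝ → ℂ) (c : ℝ) :
    circleInner f (fun θ => c • g θ) = c • circleInner f g := by
  simp only [circleInner, mul_smul_comm, intervalIntegral.integral_smul]

lemma circleNormSq_nonneg (f : ℝ → ℂ) : 0 ≤ circleNormSq f :=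
  intervalIntegral.integral_nonneg neg_pi_lt_pi.le fun _ _ => by positivity

lemma hasDerivAt_circleInner {F F' G G' : ℝ → ℝ → ℂ}
    (hF : ∀ r θ, HasDerivAt (fun s => F s θ) (F' r θ) r)
    (hG : ∀ r θ, HasDerivAt (fun s => G s θ) (G' r θ) r)
    (hFc : Continuous (Function.uncurry F)) (hFc' : Continuous (Function.uncurry F'))
    (hGc : Continuous (Function.uncurry G)) (hGc' : Continuous (Function.uncurry G')) (r : ℝ) :
    HasDerivAt (fun s => circleInner (F s) (G s))
      (circleInner (F' r) (G r) + circleInner (F r) (G' r)) r := by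
  have hF_r := hFc.uncurry_left
  have hF_r' := hFc'.uncurry_left
  have hG_r := hGc.uncurry_left
  have hG_r' := hGc'.uncurry_left
  refine (hasDerivAt_intervalIntegral_of_continuous
    (F' := fun r θ => conj (F' r θ) * G r θ + conj (F r θ) * G' r θ)
    (fun r θ => (hF r θ).star.mul (hG r θ)) (fun r => (hF_r r).star.mul (hG_r r))
    ((hFc'.star.mul hGc).add (hFc.star.mul hGc')) r).congr_deriv ?_
  exact intervalIntegral.integral_add (((hF_r' r).star.mul (hG_r r)).intervalIntegrable _ _)
    (((hF_r r).star.mul (hG_r' r)).intervalIntegrable _ _)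

lemma circleInner_deriv_left {f f' g g' : ℝ → ℂ} (hf : ∀ θ, HasDerivAt f (f' θ) θ)
    (hg : ∀ θ, HasDerivAt g (g' θ) θ) (hf' : Continuous f') (hg' : Continuous g')
    (hfper : f π = f (-π)) (hgper : g π = g (-π)) :
    circleInner f' g = -circleInner f g' := by
  have hparts := intervalIntegral.integral_mul_deriv_eq_deriv_mul (a := -π) (b := π)
    (fun θ _ => (hf θ).star) (fun θ _ => hg θ) (hf'.star.intervalIntegrable _ _)
    (hg'.intervalIntegrable _ _)
  rw [hfper, hgper, sub_self, zero_sub] at hparts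
  exact (neg_eq_iff_eq_neg.2 hparts).symm

lemma circleNormSq_add_add {f g h : ℝ → ℂ} (hf : Continuous f) (hg : Continuous g)
    (hh : Continuous h) (p q c : ℝ) :
    circleNormSq (fun θ => p * f θ + q * (-Complex.I * g θ) + c * h θ) =
      p ^ 2 * circleNormSq f + q ^ 2 * circleNormSq g + c ^ 2 * circleNormSq h +
        2 * p * q * (circleInner f g).im + 2 * p * c * (circleInner h f).re +
        2 * q * c * (circleInner h g).im := by
  have hre (f g : ℝ → ℂ) (hf : Continuous f) (hg : Continuous g) :
      (circleInner f g).re = ∫ θ in (-π)..π, (conj (f θ) * g θ).re :=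
    (Complex.reCLM.intervalIntegral_comp_comm ((hf.star.mul hg).intervalIntegrable _ _)).symm
  have him (f g : ℝ → ℂ) (hf : Continuous f) (hg : Continuous g) :
      (circleInner f g).im = ∫ θ in (-π)..π, (conj (f θ) * g θ).im :=
    (Complex.imCLM.intervalIntegral_comp_comm ((hf.star.mul hg).intervalIntegrable _ _)).symm
  rw [him f g hf hg, hre h f hh hf, him h g hh hg]
  simp only [circleNormSq, ← intervalIntegral.integral_const_mul]
  rw [← intervalIntegral.integral_add, ← intervalIntegral.integral_add,
    ← intervalIntegral.integral_add, ← intervalIntegral.integral_add,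
    ← intervalIntegral.integral_add]
  · refine intervalIntegral.integral_congr fun θ _ => ?_
    simp only [Complex.sq_norm, Complex.normSq_apply]
    simp only [neg_mul, mul_neg, Complex.add_re, Complex.mul_re, Complex.ofReal_re,
      Complex.ofReal_im, zero_mul, sub_zero, Complex.neg_re, Complex.I_re, Complex.I_im, one_mul,
      zero_sub, Complex.mul_im, zero_add, neg_neg, Complex.add_im, add_zero, Complex.neg_im,
      neg_zero, Complex.conj_re, Complex.conj_im, sub_neg_eq_add]
    ring
  all_goals exact Continuous.intervalIntegrable (by fun_prop) _ _

lemma neg_two_mul_re_circleInner_le {f g : ℝ → ℂ} (hf : Continuous f) (hg : Continuous g) :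
    -(2 * (circleInner f g).re) ≤ circleNormSq f + circleNormSq g := by
  have hsq := circleNormSq_nonneg fun θ =>
    (1 : ℝ) * g θ + (0 : ℝ) * (-Complex.I * 0) + (1 : ℝ) * f θ
  rw [circleNormSq_add_add hg continuous_const hf] at hsq
  linarith

lemma distInt_sq_mul_circleNormSq_le {f f' : ℝ → ℂ} (hf : ∀ θ, HasDerivAt f (f' θ) θ)
    (hf' : Continuous f') (hper : f π = f (-π)) (α : ℝ) :
    distInt α ^ 2 * circleNormSq f ≤
      circleNormSq f' - 2 * α * (circleInner f f').im + α ^ 2 * circleNormSq f := by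
  have hc : Continuous f := continuous_iff_continuousAt.2 fun θ => (hf θ).continuousAt
  calc distInt α ^ 2 * circleNormSq f
      ≤ circleNormSq fun θ => -Complex.I * f' θ - α * f θ :=
        distInt_sq_mul_integral_le hf hf' hper α
    _ = circleNormSq fun θ =>
          ((0 : ℝ) : ℂ) * 0 + (1 : ℝ) * (-Complex.I * f' θ) + (-α : ℝ) * f θ := by
        simp [sub_eq_add_neg]
    _ = _ := by
        rw [circleNormSq_add_add continuous_const hf' hc]
        ring

/-! ### The radial energy -/

lemma hasDerivAt_unitVec (θ : ℝ) : HasDerivAt unitVec (quarterTurn (unitVec θ)) θ := by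
  have hcoord : HasDerivAt (fun θ => ![Real.cos θ, Real.sin θ]) ![-Real.sin θ, Real.cos θ] θ := by
    refine hasDerivAt_pi.2 fun i => ?_
    fin_cases i
    · exact Real.hasDerivAt_cos θ
    · exact Real.hasDerivAt_sin θ
  exact (PiLp.continuousLinearEquiv 2 ℝ _).symm.hasFDerivAt.comp_hasDerivAt θ hcoord

lemma continuous_unitVec : Continuous unitVec := contDiff_unitVec.continuous

lemma continuous_quarterTurn : Continuous quarterTurn := by
  refine (PiLp.continuous_toLp 2 _).comp (continuous_pi fun i => ?_)
  fin_cases i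
  · exact (EuclideanSpace.proj (1 : Fin 2)).continuous.neg
  · exact (EuclideanSpace.proj (0 : Fin 2)).continuous

/-- A function on the plane in polar coordinates. -/
noncomputable def polarFun (u : Plane → ℂ) (r θ : ℝ) : ℂ := u (r • unitVec θ)

/-- The derivative of `u` in the radial direction, in polar coordinates. -/
noncomputable def radialDeriv (u : Plane → ℂ) (r θ : ℝ) : ℂ :=
  fderiv ℝ u (r • unitVec θ) (unitVec θ)

/-- The derivative of `u` along the unit tangent vector of the circle of radius `r`, in polar
coordinates. It is `r⁻¹ ∂u/∂θ` for `r ≠ 0`. -/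
noncomputable def tangentialDeriv (u : Plane → ℂ) (r θ : ℝ) : ℂ :=
  fderiv ℝ u (r • unitVec θ) (quarterTurn (unitVec θ))

/-- The expectation `⟨u, -i ∂u/∂θ⟩` of the angular momentum on the circle of radius `r`. -/
noncomputable def angularMomentum (u : Plane → ℂ) (r : ℝ) : ℝ :=
  r * (circleInner (polarFun u r) (tangentialDeriv u r)).im

lemma angularMomentum_zero (u : Plane → ℂ) : angularMomentum u 0 = 0 := zero_mul _

section PolarDerivatives

variable {u : Plane → ℂ}

lemma polarFun_pi (u : Plane → ℂ) (r : ℝ) : polarFun u r π = polarFun u r (-π) := by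
  simp [polarFun, unitVec]

lemma radialDeriv_pi (u : Plane → ℂ) (r : ℝ) : radialDeriv u r π = radialDeriv u r (-π) := by
  simp [radialDeriv, unitVec]

lemma continuous_polarFun (hu : Continuous u) : Continuous (Function.uncurry (polarFun u)) :=
  hu.comp contDiff_polar.continuous

lemma continuous_radialDeriv (hu : ContDiff ℝ 1 u) :
    Continuous (Function.uncurry (radialDeriv u)) :=
  ((hu.continuous_fderiv one_ne_zero).comp contDiff_polar.continuous).clm_apply
    (continuous_unitVec.comp continuous_snd)

lemma continuous_tangentialDeriv (hu : ContDiff ℝ 1 u) :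
    Continuous (Function.uncurry (tangentialDeriv u)) :=
  ((hu.continuous_fderiv one_ne_zero).comp contDiff_polar.continuous).clm_apply
    ((continuous_quarterTurn.comp continuous_unitVec).comp continuous_snd)

lemma hasDerivAt_smul_unitVec (r θ : ℝ) :
    HasDerivAt (fun s : ℝ => s • unitVec θ) (unitVec θ) r := by
  simpa using (hasDerivAt_id r).smul_const (unitVec θ)

lemma hasDerivAt_polarFun_left (hu : Differentiable ℝ u) (r θ : ℝ) :
    HasDerivAt (fun s => polarFun u s θ) (radialDeriv u r θ) r :=
  (hu _).hasFDerivAt.comp_hasDerivAt r (hasDerivAt_smul_unitVec r θ)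

lemma hasDerivAt_polarFun_right (hu : Differentiable ℝ u) (r θ : ℝ) :
    HasDerivAt (polarFun u r) (r • tangentialDeriv u r θ) θ := by
  refine ((hu _).hasFDerivAt.comp_hasDerivAt θ
    ((hasDerivAt_unitVec θ).const_smul r)).congr_deriv ?_
  rw [map_smul, tangentialDeriv, Pi.smul_apply]

/-- The mixed derivative `∂²u/∂r∂θ`. -/
noncomputable def mixedDeriv (u : Plane → ℂ) (r θ : ℝ) : ℂ :=
  r • fderiv ℝ (fderiv ℝ u) (r • unitVec θ) (unitVec θ) (quarterTurn (unitVec θ)) +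
    tangentialDeriv u r θ

lemma continuous_mixedDeriv (hu : ContDiff ℝ 2 u) :
    Continuous (Function.uncurry (mixedDeriv u)) := by
  have hu' : ContDiff ℝ 1 (fderiv ℝ u) := hu.fderiv_right (by norm_num)
  exact (continuous_fst.smul ((((hu'.continuous_fderiv one_ne_zero).comp
    contDiff_polar.continuous).clm_apply (continuous_unitVec.comp continuous_snd)).clm_apply
    ((continuous_quarterTurn.comp continuous_unitVec).comp continuous_snd))).add
    (continuous_tangentialDeriv (hu.of_le one_le_two))

lemma hasDerivAt_smul_tangentialDeriv (hu : ContDiff ℝ 2 u) (r θ : ℝ) :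
    HasDerivAt (fun s => s • tangentialDeriv u s θ) (mixedDeriv u r θ) r := by
  have hu' : ContDiff ℝ 1 (fderiv ℝ u) := hu.fderiv_right (by norm_num)
  have htan := (((hu'.differentiable one_ne_zero) _).hasFDerivAt.comp_hasDerivAt r
    (hasDerivAt_smul_unitVec r θ)).clm_apply (hasDerivAt_const r (quarterTurn (unitVec θ)))
  refine ((hasDerivAt_id r).smul htan).congr_deriv ?_
  simp [mixedDeriv, tangentialDeriv]

lemma hasDerivAt_radialDeriv_right (hu : ContDiff ℝ 2 u) (r θ : ℝ) :
    HasDerivAt (radialDeriv u r) (mixedDeriv u r θ) θ := by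
  have hu' : ContDiff ℝ 1 (fderiv ℝ u) := hu.fderiv_right (by norm_num)
  have hsymm : IsSymmSndFDerivAt ℝ u (r • unitVec θ) :=
    hu.contDiffAt.isSymmSndFDerivAt (by simp)
  refine ((((hu'.differentiable one_ne_zero) _).hasFDerivAt.comp_hasDerivAt θ
    ((hasDerivAt_unitVec θ).const_smul r)).clm_apply (hasDerivAt_unitVec θ)).congr_deriv ?_
  simp [mixedDeriv, tangentialDeriv, hsymm.eq (unitVec θ) (quarterTurn (unitVec θ))]

lemma hasDerivAt_circleNormSq_polarFun (hu : ContDiff ℝ 1 u) (r : ℝ) :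
    HasDerivAt (fun s => circleNormSq (polarFun u s))
      (2 * (circleInner (polarFun u r) (radialDeriv u r)).re) r := by
  have hd := hasDerivAt_polarFun_left (hu.differentiable one_ne_zero)
  have hc := continuous_polarFun hu.continuous
  have hc' := continuous_radialDeriv hu
  have hre := Complex.reCLM.hasFDerivAt.comp_hasDerivAt r
    (hasDerivAt_circleInner hd hd hc hc' hc hc' r)
  refine (hre.congr_deriv ?_).congr_of_eventuallyEq (.of_forall fun s => ?_)
  · rw [← conj_circleInner (polarFun u r) (radialDeriv u r)]
    simp [two_mul]
  · simp [circleInner_self]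

lemma hasDerivAt_angularMomentum (hu : ContDiff ℝ 2 u) (r : ℝ) :
    HasDerivAt (angularMomentum u)
      (2 * r * (circleInner (radialDeriv u r) (tangentialDeriv u r)).im) r := by
  have hu1 : ContDiff ℝ 1 u := hu.of_le one_le_two
  have hd : Differentiable ℝ u := hu1.differentiable one_ne_zero
  have hsmul : Continuous (Function.uncurry fun r θ => r • tangentialDeriv u r θ) :=
    continuous_fst.smul (continuous_tangentialDeriv hu1)
  have hparts : circleInner (fun θ => r • tangentialDeriv u r θ) (radialDeriv u r) =
      -circleInner (polarFun u r) (mixedDeriv u r) :=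
    circleInner_deriv_left (hasDerivAt_polarFun_right hd r) (hasDerivAt_radialDeriv_right hu r)
      (hsmul.uncurry_left r) ((continuous_mixedDeriv hu).uncurry_left r) (polarFun_pi u r)
      (radialDeriv_pi u r)
  have him := Complex.imCLM.hasFDerivAt.comp_hasDerivAt r (hasDerivAt_circleInner
    (hasDerivAt_polarFun_left hd) (fun r θ => hasDerivAt_smul_tangentialDeriv hu r θ)
    (continuous_polarFun hu.continuous) (continuous_radialDeriv hu1) hsmul
    (continuous_mixedDeriv hu) r)
  refine (him.congr_deriv ?_).congr_of_eventuallyEq (.of_forall fun s => ?_)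
  · rw [← neg_eq_iff_eq_neg.2 hparts, ← conj_circleInner (radialDeriv u r),
      circleInner_smul_right]
    simp only [Complex.real_smul, map_mul, Complex.conj_ofReal, Complex.imCLM_apply, Complex.add_im,
      Complex.mul_im, Complex.ofReal_re, Complex.ofReal_im, zero_mul, add_zero, Complex.neg_im,
      Complex.conj_im, mul_neg, Complex.conj_re, neg_neg]
    ring
  · simp only [angularMomentum, Function.comp_apply, circleInner_smul_right, Complex.imCLM_apply,
      Complex.smul_im, smul_eq_mul]

lemma distInt_sq_mul_circleNormSq_polarFun_le (hu : ContDiff ℝ 1 u) (r α : ℝ) :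
    distInt α ^ 2 * circleNormSq (polarFun u r) ≤
      r ^ 2 * circleNormSq (tangentialDeriv u r) - 2 * α * angularMomentum u r +
        α ^ 2 * circleNormSq (polarFun u r) := by
  have h := distInt_sq_mul_circleNormSq_le
    (hasDerivAt_polarFun_right (hu.differentiable one_ne_zero) r)
    (((continuous_tangentialDeriv hu).uncurry_left r).const_smul r) (polarFun_pi u r) α
  rw [circleInner_smul_right, Complex.smul_im, smul_eq_mul] at h
  simpa [circleNormSq, mul_pow, angularMomentum] using h

end PolarDerivatives

/-- The energy of `u` on the circle of radius `r` in the radial gauge with angular potential `a`,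
with the field term integrated by parts in the radius. -/
noncomputable def radialEnergy (a : ℝ → ℝ) (u : Plane → ℂ) (r : ℝ) : ℝ :=
  r * (circleNormSq (radialDeriv u r) + circleNormSq (tangentialDeriv u r) +
      a r ^ 2 * circleNormSq (polarFun u r) -
      2 * a r * (circleInner (polarFun u r) (radialDeriv u r)).re) -
    2 * a r * angularMomentum u r

section RadialEnergy

variable {a : ℝ → ℝ} {u : Plane → ℂ} {r : ℝ}

lemma continuous_circleInner {F G : ℝ → ℝ → ℂ} (hF : Continuous (Function.uncurry F))
    (hG : Continuous (Function.uncurry G)) : Continuous fun r => circleInner (F r) (G r) :=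
  intervalIntegral.continuous_parametric_intervalIntegral_of_continuous' (hF.star.mul hG) _ _

lemma continuous_circleNormSq {F : ℝ → ℝ → ℂ} (hF : Continuous (Function.uncurry F)) :
    Continuous fun r => circleNormSq (F r) :=
  intervalIntegral.continuous_parametric_intervalIntegral_of_continuous' (hF.norm.pow 2) _ _

lemma continuous_radialEnergy (ha : Continuous a) (hu : ContDiff ℝ 1 u) :
    Continuous (radialEnergy a u) := by
  have hN := continuous_circleNormSq (continuous_polarFun hu.continuous)
  have hP := continuous_circleNormSq (continuous_radialDeriv hu)
  have hQ := continuous_circleNormSq (continuous_tangentialDeriv hu)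
  have hS := continuous_circleInner (continuous_polarFun hu.continuous) (continuous_radialDeriv hu)
  have hJ := continuous_circleInner (continuous_polarFun hu.continuous)
    (continuous_tangentialDeriv hu)
  unfold radialEnergy angularMomentum
  fun_prop

lemma neg_deriv_angularMomentum_le_radialEnergy (a : ℝ → ℝ) (hu : ContDiff ℝ 1 u) (hr : 0 ≤ r) :
    -(2 * r * (circleInner (radialDeriv u r) (tangentialDeriv u r)).im) ≤
      radialEnergy a u r := by
  have hsq := mul_nonneg hr (circleNormSq_nonneg fun θ => (1 : ℝ) * radialDeriv u r θ +
    (1 : ℝ) * (-Complex.I * tangentialDeriv u r θ) + (-a r : ℝ) * polarFun u r θ)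
  rw [circleNormSq_add_add ((continuous_radialDeriv hu).uncurry_left r)
    ((continuous_tangentialDeriv hu).uncurry_left r)
    ((continuous_polarFun hu.continuous).uncurry_left r)] at hsq
  rw [radialEnergy, angularMomentum]
  linarith

lemma le_radialEnergy_of_radialDeriv (a : ℝ → ℝ) (hu : ContDiff ℝ 1 u) (hr : 0 ≤ r) (c : ℝ) :
    -2 * a r * angularMomentum u r -
        2 * c * r ^ 2 * (circleInner (polarFun u r) (radialDeriv u r)).re +
        (2 * a r * c * r ^ 2 - c ^ 2 * r ^ 3) * circleNormSq (polarFun u r) ≤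
      radialEnergy a u r := by
  have hsq := mul_nonneg hr (circleNormSq_nonneg fun θ => (1 : ℝ) * radialDeriv u r θ +
    (0 : ℝ) * (-Complex.I * tangentialDeriv u r θ) + (c * r - a r : ℝ) * polarFun u r θ)
  rw [circleNormSq_add_add ((continuous_radialDeriv hu).uncurry_left r)
    ((continuous_tangentialDeriv hu).uncurry_left r)
    ((continuous_polarFun hu.continuous).uncurry_left r)] at hsq
  have htan := mul_nonneg hr (circleNormSq_nonneg (tangentialDeriv u r))
  rw [radialEnergy]
  linarith

lemma le_radialEnergy_of_mul_eq (hu : ContDiff ℝ 1 u) (hr : 0 < r) {α : ℝ} (ha : a r * r = α) :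
    distInt α ^ 2 * circleNormSq (polarFun u r) / r -
        2 * α * (circleInner (polarFun u r) (radialDeriv u r)).re ≤
      radialEnergy a u r := by
  have hrad := mul_nonneg hr.le (circleNormSq_nonneg (radialDeriv u r))
  have hpoincare := (div_le_div_iff_of_pos_right hr).2
    (distInt_sq_mul_circleNormSq_polarFun_le hu r α)
  have henergy : radialEnergy a u r = r * circleNormSq (radialDeriv u r) +
      (r ^ 2 * circleNormSq (tangentialDeriv u r) - 2 * α * angularMomentum u r +
        α ^ 2 * circleNormSq (polarFun u r)) / r -
      2 * α * (circleInner (polarFun u r) (radialDeriv u r)).re := by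
    rw [radialEnergy, ← ha]
    field_simp
    ring
  linarith

/-- The density in the radius of the difference of the two sides of the Hardy inequality with
constant `κ`. -/
noncomputable def radialDeficit (a : ℝ → ℝ) (u : Plane → ℂ) (κ R r : ℝ) : ℝ :=
  radialEnergy a u r - κ * (circleNormSq (polarFun u r) * (r / (R ^ 2 + r ^ 2)))

lemma continuous_hardyWeight {R : ℝ} (hR : 0 < R) :
    Continuous fun r : ℝ => r / (R ^ 2 + r ^ 2) :=
  continuous_id.div₀ (by fun_prop) fun r => by positivity

lemma continuous_radialDeficit (ha : Continuous a) (hu : ContDiff ℝ 1 u) (κ : ℝ) {R : ℝ}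
    (hR : 0 < R) : Continuous (radialDeficit a u κ R) :=
  (continuous_radialEnergy ha hu).sub (continuous_const.mul
    ((continuous_circleNormSq (continuous_polarFun hu.continuous)).mul (continuous_hardyWeight hR)))

lemma mul_div_le_two_mul_sub {μ R : ℝ} (hμ : μ ^ 2 ≤ 1) (hR : 0 < R) (hr : r ∈ Icc 0 R) :
    μ ^ 2 * (r / (R ^ 2 + r ^ 2)) ≤ 2 * (μ ^ 2 / R ^ 2) * r - (μ ^ 2 / R ^ 2) ^ 2 * r ^ 3 := by
  have hc : μ ^ 2 / R ^ 2 * r ^ 2 ≤ 1 := by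
    rw [div_mul_eq_mul_div, div_le_one (by positivity)]
    nlinarith [pow_le_pow_left₀ hr.1 hr.2 2, sq_nonneg r]
  have hcr : 0 ≤ μ ^ 2 / R ^ 2 * r := mul_nonneg (by positivity) hr.1
  calc μ ^ 2 * (r / (R ^ 2 + r ^ 2)) ≤ μ ^ 2 * (r / R ^ 2) := by
        have := hr.1
        gcongr
        exact le_add_of_nonneg_right (sq_nonneg r)
    _ = μ ^ 2 / R ^ 2 * r := by ring
    _ ≤ _ := by nlinarith

/-- The squared modulus `e^{2 (h(r) - h(0))}` of the zero mode `e^h`, normalised at the origin. It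
decreases from `1` at the origin to the constant `β₊` on the circle of radius `R`. -/
noncomputable def zeroModeWeight (b : ℝ → ℝ) (r : ℝ) : ℝ :=
  Real.exp (2 * (radialPotential b r - radialPotential b 0))

lemma zeroModeWeight_nonneg (b : ℝ → ℝ) (r : ℝ) : 0 ≤ zeroModeWeight b r := Real.exp_nonneg _

end RadialEnergy

namespace IsRadialProfile

variable {b : ℝ → ℝ} {R : ℝ} {u : Plane → ℂ}

lemma hasDerivAt_zeroModeWeight (hb : IsRadialProfile b R) (r : ℝ) :
    HasDerivAt (zeroModeWeight b) (-2 * angularPotential b r * zeroModeWeight b r) r :=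
  (((hb.hasDerivAt_radialPotential r).sub_const _).const_mul 2).exp.congr_deriv
    (by rw [zeroModeWeight]; ring)

lemma antitone_zeroModeWeight (hb : IsRadialProfile b R) : Antitone (zeroModeWeight b) :=
  fun _ _ h => Real.exp_le_exp.2 (by linarith [hb.antitone_radialPotential h])

lemma zeroModeWeight_le_one (hb : IsRadialProfile b R) {r : ℝ} (hr : 0 ≤ r) :
    zeroModeWeight b r ≤ 1 := by
  simpa [zeroModeWeight] using hb.antitone_zeroModeWeight hr

lemma zeroModeWeight_self (hb : IsRadialProfile b R) :
    zeroModeWeight b R = Real.exp (2 * logMoment b R) / R ^ (2 * flux (radialField b)) := by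
  rw [zeroModeWeight, hb.radialPotential_zero, hb.radialPotential_of_ge le_rfl, hb.flux_radialField,
    Real.rpow_def_of_pos hb.pos, ← Real.exp_sub]
  congr 1
  ring

lemma le_integral_radialDeficit_inner (hb : IsRadialProfile b R) (hu : ContDiff ℝ 2 u) {μ : ℝ}
    (hμ : μ ^ 2 ≤ 1) :
    -(1 - zeroModeWeight b R) * angularMomentum u R -
        zeroModeWeight b R * μ ^ 2 * circleNormSq (polarFun u R) ≤
      ∫ r in (0 : ℝ)..R,
        radialDeficit (angularPotential b) u (zeroModeWeight b R * μ ^ 2) R r := by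
  have hR := hb.pos
  have hu1 : ContDiff ℝ 1 u := hu.of_le one_le_two
  set c : ℝ := μ ^ 2 / R ^ 2 with hc
  have hG (r : ℝ) : HasDerivAt (fun r => -((1 - zeroModeWeight b r) * angularMomentum u r) -
      c * r ^ 2 * (zeroModeWeight b r * circleNormSq (polarFun u r))) _ r :=
    (((hb.hasDerivAt_zeroModeWeight r).const_sub 1).mul
      (hasDerivAt_angularMomentum hu r)).neg.sub (((hasDerivAt_pow 2 r).const_mul c).mul
        ((hb.hasDerivAt_zeroModeWeight r).mul (hasDerivAt_circleNormSq_polarFun hu1 r)))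
  have key := intervalIntegral.sub_le_integral_of_hasDeriv_right_of_le hR.le
    (fun r _ => (hG r).continuousAt.continuousWithinAt) (fun r _ => (hG r).hasDerivWithinAt)
    (continuous_radialDeficit hb.continuous_angularPotential hu1
      (zeroModeWeight b R * μ ^ 2) hR).integrableOn_Icc fun r hr => ?_
  · refine le_of_eq_of_le ?_ key
    rw [angularMomentum_zero, hc]
    field_simp
    ring
  · have hN := circleNormSq_nonneg (polarFun u r)
    have hw := hb.antitone_zeroModeWeight hr.2.le
    have hangular := mul_le_mul_of_nonneg_left
      (neg_deriv_angularMomentum_le_radialEnergy (angularPotential b) hu1 hr.1.le)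
      (sub_nonneg.2 (hb.zeroModeWeight_le_one hr.1.le))
    have hradial := mul_le_mul_of_nonneg_left
      (le_radialEnergy_of_radialDeriv (angularPotential b) hu1 hr.1.le c)
      (zeroModeWeight_nonneg b r)
    have hweight : zeroModeWeight b R * (μ ^ 2 * (r / (R ^ 2 + r ^ 2))) ≤
        zeroModeWeight b r * (2 * c * r - c ^ 2 * r ^ 3) :=
      mul_le_mul hw (mul_div_le_two_mul_sub hμ hR ⟨hr.1.le, hr.2.le⟩)
        (mul_nonneg (sq_nonneg μ) (div_nonneg hr.1.le (by positivity))) (zeroModeWeight_nonneg b r)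
    have hweightN := mul_le_mul_of_nonneg_right hweight hN
    rw [radialDeficit]
    simp only [Nat.cast_ofNat]
    linarith

lemma le_integral_radialDeficit_outer (hb : IsRadialProfile b R) (hu : ContDiff ℝ 2 u) {M : ℝ}
    (hM : R ≤ M) (huM : ∀ x, ‖x‖ = M → u x = 0) {β : ℝ} (hβ0 : 0 ≤ β) (hβ1 : β ≤ 1) :
    (1 - β) * angularMomentum u R + β * flux (radialField b) * circleNormSq (polarFun u R) ≤
      ∫ r in R..M, radialDeficit (angularPotential b) u
        (β * distInt (flux (radialField b)) ^ 2) R r := by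
  have hu1 : ContDiff ℝ 1 u := hu.of_le one_le_two
  set α := flux (radialField b)
  have hG (r : ℝ) : HasDerivAt (fun r => -((1 - β) * angularMomentum u r) -
      β * α * circleNormSq (polarFun u r)) _ r :=
    ((hasDerivAt_angularMomentum hu r).const_mul (1 - β)).neg.sub
      ((hasDerivAt_circleNormSq_polarFun hu1 r).const_mul (β * α))
  have hzero : polarFun u M = 0 :=
    funext fun θ => huM _ (norm_smul_unitVec (hb.pos.le.trans hM) θ)
  have key := intervalIntegral.sub_le_integral_of_hasDeriv_right_of_le hM
    (fun r _ => (hG r).continuousAt.continuousWithinAt) (fun r _ => (hG r).hasDerivWithinAt)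
    (continuous_radialDeficit hb.continuous_angularPotential hu1
      (β * distInt α ^ 2) hb.pos).integrableOn_Icc fun r hr => ?_
  · refine le_of_eq_of_le ?_ key
    simp [angularMomentum, hzero, circleInner, circleNormSq, add_comm]
  · have hr0 : 0 < r := hb.pos.trans hr.1
    have haα : angularPotential b r * r = α := by
      rw [angularPotential_mul_self, hb.radialFlux_of_ge hr.1.le, ← hb.flux_radialField]
    have hangular := mul_le_mul_of_nonneg_left
      (neg_deriv_angularMomentum_le_radialEnergy (angularPotential b) hu1 hr0.le)
      (sub_nonneg.2 hβ1)
    have hhardy := mul_le_mul_of_nonneg_left (le_radialEnergy_of_mul_eq hu1 hr0 haα) hβ0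
    have hweight : β * distInt α ^ 2 * (circleNormSq (polarFun u r) * (r / (R ^ 2 + r ^ 2))) ≤
        β * (distInt α ^ 2 * circleNormSq (polarFun u r) / r) := by
      rw [mul_assoc β, mul_div_assoc, div_eq_mul_inv _ r]
      have hN := circleNormSq_nonneg (polarFun u r)
      have hinv : r / (R ^ 2 + r ^ 2) ≤ r⁻¹ := by
        rw [div_le_iff₀ (by positivity), inv_mul_eq_div, le_div_iff₀ hr0]
        nlinarith [sq_nonneg R]
      gcongr
    rw [radialDeficit]
    linarith

lemma integral_radialDeficit_nonneg (hb : IsRadialProfile b R) (hu : ContDiff ℝ 2 u) {M : ℝ}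
    (hM : R ≤ M) (huM : ∀ x, ‖x‖ = M → u x = 0) :
    0 ≤ ∫ r in (0 : ℝ)..M, radialDeficit (angularPotential b) u
      (zeroModeWeight b R * distInt (flux (radialField b)) ^ 2) R r := by
  have hcont := continuous_radialDeficit hb.continuous_angularPotential (hu.of_le one_le_two)
    (zeroModeWeight b R * distInt (flux (radialField b)) ^ 2) hb.pos
  have hα : 0 ≤ flux (radialField b) := by
    rw [hb.flux_radialField]
    exact integral_nonneg hb.mul_id_nonneg
  have hμα : distInt (flux (radialField b)) ≤ flux (radialField b) := by
    simpa [abs_of_nonneg hα] using distInt_le (flux (radialField b)) 0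
  have hμ0 := distInt_nonneg (flux (radialField b))
  have hμ := distInt_le_half (flux (radialField b))
  have hinner := hb.le_integral_radialDeficit_inner hu (μ := distInt (flux (radialField b)))
    (by nlinarith)
  have houter := hb.le_integral_radialDeficit_outer hu hM huM (zeroModeWeight_nonneg b R)
    (hb.zeroModeWeight_le_one hb.pos.le)
  have hboundary := mul_nonneg (mul_nonneg (zeroModeWeight_nonneg b R)
    (by nlinarith : 0 ≤ flux (radialField b) - distInt (flux (radialField b)) ^ 2))
    (circleNormSq_nonneg (polarFun u R))
  rw [← intervalIntegral.integral_add_adjacent_intervals (hcont.intervalIntegrable 0 R)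
    (hcont.intervalIntegrable R M)]
  linarith

end IsRadialProfile

/-! ### The Hardy inequality for test functions -/

/-- The family of classical partial derivatives, to be compared with a weak gradient. -/
noncomputable def classicalGradient (u : Plane → ℂ) (j : Fin 2) (x : Plane) : ℂ :=
  fderiv ℝ u x (EuclideanSpace.single j (1 : ℝ))

/-- The magnetic gradient `(i∇ + A_h) u`, with `g` in place of the gradient of `u`. -/
noncomputable def magneticGradient (B : Plane → ℝ) (u : Plane → ℂ) (g : Fin 2 → Plane → ℂ)
    (j : Fin 2) (x : Plane) : ℂ :=
  Complex.I * g j x + (vectorPotential B x j : ℂ) * u x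

/-- The density `|(i∇ + A_h) u|²`, with `g` in place of the gradient of `u`. -/
noncomputable def kineticDensity (B : Plane → ℝ) (u : Plane → ℂ) (g : Fin 2 → Plane → ℂ)
    (x : Plane) : ℝ :=
  ∑ j, ‖magneticGradient B u g j x‖ ^ 2

section TestFunctions

variable {u : Plane → ℂ}

lemma continuous_classicalGradient (hu : ContDiff ℝ 1 u) (j : Fin 2) :
    Continuous (classicalGradient u j) :=
  (hu.continuous_fderiv one_ne_zero).clm_apply continuous_const

lemma hasCompactSupport_classicalGradient (hs : HasCompactSupport u) (j : Fin 2) :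
    HasCompactSupport (classicalGradient u j) :=
  hs.fderiv_apply ℝ _

lemma memLp_classicalGradient (hu : ContDiff ℝ 1 u) (hs : HasCompactSupport u) (j : Fin 2) :
    MemLp (classicalGradient u j) 2 :=
  (continuous_classicalGradient hu j).memLp_of_hasCompactSupport
    (hasCompactSupport_classicalGradient hs j)

lemma fderiv_eq_sum_classicalGradient (u : Plane → ℂ) (x v : Plane) :
    fderiv ℝ u x v = ∑ j, v j • classicalGradient u j x := by
  conv_lhs => rw [← (EuclideanSpace.basisFun (Fin 2) ℝ).sum_repr v]
  simp [classicalGradient]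

lemma sum_norm_sq_eq_frame (z : Fin 2 → ℂ) (θ : ℝ) :
    ∑ j, ‖z j‖ ^ 2 =
      ‖∑ j, unitVec θ j • z j‖ ^ 2 + ‖∑ j, quarterTurn (unitVec θ) j • z j‖ ^ 2 := by
  simp only [Complex.sq_norm, Complex.normSq_apply, Fin.sum_univ_two, Fin.isValue, unitVec,
    Complex.real_smul, Matrix.cons_val_zero, Matrix.cons_val_one, Matrix.cons_val_fin_one,
    Complex.add_re, Complex.mul_re, Complex.ofReal_re, Complex.ofReal_im, zero_mul, sub_zero,
    Complex.add_im, Complex.mul_im, add_zero, quarterTurn, Complex.ofReal_neg, neg_mul,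
    Complex.neg_re, Complex.neg_im]
  linear_combination (-((z 0).re ^ 2 + (z 0).im ^ 2 + (z 1).re ^ 2 + (z 1).im ^ 2)) *
    Real.sin_sq_add_cos_sq θ

lemma sum_norm_sq_classicalGradient (u : Plane → ℂ) (r θ : ℝ) :
    ∑ j, ‖classicalGradient u j (r • unitVec θ)‖ ^ 2 =
      ‖radialDeriv u r θ‖ ^ 2 + ‖tangentialDeriv u r θ‖ ^ 2 := by
  rw [sum_norm_sq_eq_frame _ θ, radialDeriv, tangentialDeriv, fderiv_eq_sum_classicalGradient,
    fderiv_eq_sum_classicalGradient]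

lemma inner_quarterTurn_self (x : Plane) : inner ℝ (quarterTurn x) x = 0 := by
  simp [PiLp.inner_apply, quarterTurn, mul_comm]

lemma IsRadialProfile.kineticDensity_smul_unitVec {b : ℝ → ℝ} {R : ℝ} (hb : IsRadialProfile b R)
    (u : Plane → ℂ) {r : ℝ} (hr : 0 < r) (θ : ℝ) :
    kineticDensity (radialField b) u (classicalGradient u) (r • unitVec θ) =
      ‖radialDeriv u r θ‖ ^ 2 +
        ‖-Complex.I * tangentialDeriv u r θ - angularPotential b r * polarFun u r θ‖ ^ 2 := by
  have hframe (v : Plane) :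
      ∑ j, v j • magneticGradient (radialField b) u (classicalGradient u) j (r • unitVec θ) =
      Complex.I * fderiv ℝ u (r • unitVec θ) v + (angularPotential b r *
        inner ℝ (quarterTurn (unitVec θ)) v : ℝ) * polarFun u r θ := by
    simp only [magneticGradient, hb.vectorPotential_smul_unitVec hr,
      fderiv_eq_sum_classicalGradient, polarFun, Fin.sum_univ_two, PiLp.inner_apply,
      PiLp.smul_apply, smul_eq_mul, Complex.real_smul, Complex.ofReal_mul, Complex.ofReal_add,
      RCLike.inner_apply, conj_trivial]
    ring
  rw [kineticDensity, sum_norm_sq_eq_frame _ θ, hframe, hframe, real_inner_self_eq_norm_sq,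
    norm_quarterTurn, norm_unitVec, inner_quarterTurn_self]
  congr 2
  · simp [radialDeriv]
  · rw [← norm_neg, tangentialDeriv]
    simp [add_comm, sub_eq_add_neg]

lemma exists_forall_le_norm_notMem_tsupport {E F : Type*} [SeminormedAddCommGroup E] [Zero F]
    {f : E → F} (hf : HasCompactSupport f) (R : ℝ) :
    ∃ M, R ≤ M ∧ ∀ x, M ≤ ‖x‖ → x ∉ tsupport f := by
  obtain ⟨M, -, hM⟩ := hf.isCompact.isBounded.exists_pos_norm_lt
  exact ⟨max R M, le_max_left _ _, fun x hx hxf => ((le_max_right R M).trans hx).not_gt (hM x hxf)⟩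

end TestFunctions

section PolarCompactSupport

variable {F : Type*} [NormedAddCommGroup F] [NormedSpace ℝ F]

lemma integral_polar_of_forall_le_norm {f : Plane → F} (hm : StronglyMeasurable f)
    (hf : Integrable f) {M : ℝ} (hM : 0 ≤ M) (hfM : ∀ x, M ≤ ‖x‖ → f x = 0) :
    ∫ x, f x = ∫ r in (0 : ℝ)..M, r • ∫ θ in (-π)..π, f (r • unitVec θ) := by
  rw [integral_polar_iterated hm hf, intervalIntegral.integral_of_le hM]
  refine setIntegral_eq_of_subset_of_forall_sdiff_eq_zero measurableSet_Ioi Ioc_subset_Ioi_self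
    fun r hr => ?_
  have hr0 : 0 < r := hr.1
  have hMr : M ≤ r := by
    by_contra! h
    exact hr.2 ⟨hr0, h.le⟩
  simp [hfM _ (hMr.trans (norm_smul_unitVec hr0.le _).ge)]

lemma integral_polar_congr {f : Plane → ℝ} (hm : StronglyMeasurable f) (hf : Integrable f) {M : ℝ}
    (hM : 0 ≤ M) (hfM : ∀ x, M ≤ ‖x‖ → f x = 0) {g : ℝ → ℝ}
    (hfg : ∀ r, 0 < r → r * ∫ θ in (-π)..π, f (r • unitVec θ) = g r) :
    ∫ x, f x = ∫ r in (0 : ℝ)..M, g r := by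
  rw [integral_polar_of_forall_le_norm hm hf hM hfM]
  refine intervalIntegral.integral_congr_uIoo fun r hr => hfg r ?_
  rw [uIoo_of_le hM] at hr
  exact hr.1

end PolarCompactSupport

section PolarNorms

variable {u : Plane → ℂ} {R : ℝ}

lemma integrable_hardyWeight (hR : R ≠ 0) (hu : MemLp u 2) :
    Integrable fun x => ‖u x‖ ^ 2 / (R ^ 2 + ‖x‖ ^ 2) := by
  simp only [div_eq_mul_inv]
  refine (hu.integrable_norm_pow two_ne_zero).mul_bdd (c := (R ^ 2)⁻¹)
    (Continuous.inv₀ (by fun_prop) fun x => by positivity).aestronglyMeasurable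
    (.of_forall fun x => ?_)
  rw [Real.norm_of_nonneg (by positivity)]
  gcongr
  exact le_add_of_nonneg_right (sq_nonneg _)

lemma integral_hardyWeight (hR : R ≠ 0) (hu : Continuous u) (hs : HasCompactSupport u) {M : ℝ}
    (hM : 0 ≤ M) (huM : ∀ x, M ≤ ‖x‖ → u x = 0) :
    ∫ x, ‖u x‖ ^ 2 / (R ^ 2 + ‖x‖ ^ 2) =
      ∫ r in (0 : ℝ)..M, circleNormSq (polarFun u r) * (r / (R ^ 2 + r ^ 2)) := by
  have hm : Measurable fun x => ‖u x‖ ^ 2 / (R ^ 2 + ‖x‖ ^ 2) :=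
    (hu.norm.pow 2).measurable.div (by fun_prop)
  refine integral_polar_congr hm.stronglyMeasurable
    (integrable_hardyWeight hR (hu.memLp_of_hasCompactSupport hs)) hM
    (fun x hx => by simp [huM x hx]) fun r hr => ?_
  simp only [norm_smul_unitVec hr.le, intervalIntegral.integral_div, circleNormSq, polarFun]
  ring

lemma integral_norm_sq_add_gradient (hu : ContDiff ℝ 1 u) (hs : HasCompactSupport u) {M : ℝ}
    (hM : 0 ≤ M) (huM : ∀ x, M ≤ ‖x‖ → x ∉ tsupport u) :
    ∫ x, (‖u x‖ ^ 2 + ∑ j, ‖classicalGradient u j x‖ ^ 2) =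
      ∫ r in (0 : ℝ)..M, r * (circleNormSq (polarFun u r) + circleNormSq (radialDeriv u r) +
        circleNormSq (tangentialDeriv u r)) := by
  have hgrad := continuous_classicalGradient hu
  have hm : Continuous fun x => ‖u x‖ ^ 2 + ∑ j, ‖classicalGradient u j x‖ ^ 2 := by fun_prop
  have hi : Integrable fun x => ‖u x‖ ^ 2 + ∑ j, ‖classicalGradient u j x‖ ^ 2 :=
    ((hu.continuous.memLp_of_hasCompactSupport hs).integrable_norm_pow two_ne_zero).add
      (integrable_finsetSum _ fun j _ =>
        (memLp_classicalGradient hu hs j).integrable_norm_pow two_ne_zero)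
  have hzero (x : Plane) (hx : M ≤ ‖x‖) : ‖u x‖ ^ 2 + ∑ j, ‖classicalGradient u j x‖ ^ 2 = 0 := by
    simp [classicalGradient, fderiv_of_notMem_tsupport ℝ (huM x hx),
      image_eq_zero_of_notMem_tsupport (huM x hx)]
  refine integral_polar_congr hm.stronglyMeasurable hi hM hzero fun r _ => ?_
  have hU : Continuous fun θ => u (r • unitVec θ) :=
    (continuous_polarFun hu.continuous).uncurry_left r
  have hUr := (continuous_radialDeriv hu).uncurry_left r
  have hUt := (continuous_tangentialDeriv hu).uncurry_left r
  simp only [sum_norm_sq_classicalGradient, ← add_assoc]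
  rw [intervalIntegral.integral_add, intervalIntegral.integral_add]
  · rfl
  · exact (hU.norm.pow 2).intervalIntegrable _ _
  · exact (hUr.norm.pow 2).intervalIntegrable _ _
  · exact ((hU.norm.pow 2).add (hUr.norm.pow 2)).intervalIntegrable _ _
  · exact (hUt.norm.pow 2).intervalIntegrable _ _

end PolarNorms

namespace IsRadialProfile

variable {b : ℝ → ℝ} {R : ℝ} {u : Plane → ℂ}

lemma memLp_magneticGradient (hb : IsRadialProfile b R) {g : Fin 2 → Plane → ℂ}
    (hu : MemLp u 2) (hg : ∀ j, MemLp (g j) 2) (j : Fin 2) :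
    MemLp (magneticGradient (radialField b) u g j) 2 := by
  have hA : MemLp (fun x => (vectorPotential (radialField b) x j : ℂ)) ⊤ :=
    memLp_top_of_bound (Complex.measurable_ofReal.comp
      (hb.measurable_vectorPotential j)).aestronglyMeasurable (potentialBound b)
      (.of_forall fun x => (Complex.norm_real _).trans_le (hb.abs_vectorPotential_le x j))
  exact ((hg j).const_mul _).add (hu.mul hA)

lemma integrable_kineticDensity (hb : IsRadialProfile b R) {g : Fin 2 → Plane → ℂ}
    (hu : MemLp u 2) (hg : ∀ j, MemLp (g j) 2) :
    Integrable (kineticDensity (radialField b) u g) :=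
  integrable_finsetSum _ fun j _ =>
    (hb.memLp_magneticGradient hu hg j).integrable_norm_pow two_ne_zero

lemma measurable_kineticDensity (hb : IsRadialProfile b R) {g : Fin 2 → Plane → ℂ}
    (hu : Measurable u) (hg : ∀ j, Measurable (g j)) :
    Measurable (kineticDensity (radialField b) u g) :=
  Finset.measurable_fun_sum _ fun j _ => (((hg j).const_mul _).add
    ((Complex.measurable_ofReal.comp (hb.measurable_vectorPotential j)).mul hu)).norm.pow_const 2

lemma integrable_radialField_mul_norm_sq (hb : IsRadialProfile b R) (hu : Continuous u)
    (hs : HasCompactSupport u) : Integrable fun x => radialField b x * ‖u x‖ ^ 2 := by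
  obtain ⟨C, hC⟩ := hs.exists_bound_of_continuous hu
  refine hb.integrable_radialField.mul_bdd (c := C ^ 2) (hu.norm.pow 2).aestronglyMeasurable
    (.of_forall fun x => ?_)
  rw [norm_pow, norm_norm]
  exact pow_le_pow_left₀ (norm_nonneg _) (hC x) 2

lemma integral_kineticDensity_circle (hb : IsRadialProfile b R) (hu : ContDiff ℝ 1 u) {r : ℝ}
    (hr : 0 < r) :
    r * ∫ θ in (-π)..π, kineticDensity (radialField b) u (classicalGradient u) (r • unitVec θ) =
      radialEnergy (angularPotential b) u r +
        2 * radialFlux b r * (circleInner (polarFun u r) (radialDeriv u r)).re := by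
  have hU := (continuous_polarFun hu.continuous).uncurry_left r
  have hUr := (continuous_radialDeriv hu).uncurry_left r
  have hUt := (continuous_tangentialDeriv hu).uncurry_left r
  have hangular : ∫ θ in (-π)..π,
      ‖-Complex.I * tangentialDeriv u r θ - angularPotential b r * polarFun u r θ‖ ^ 2 =
      circleNormSq (tangentialDeriv u r) + angularPotential b r ^ 2 * circleNormSq (polarFun u r) -
        2 * angularPotential b r * (circleInner (polarFun u r) (tangentialDeriv u r)).im := by
    have hcomb := circleNormSq_add_add hUr hUt hU 0 1 (-angularPotential b r)
    simpa [circleNormSq, ← sub_eq_add_neg] using hcomb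
  simp only [hb.kineticDensity_smul_unitVec u hr]
  rw [intervalIntegral.integral_add (Continuous.intervalIntegrable (by fun_prop) _ _)
    (Continuous.intervalIntegrable (by fun_prop) _ _), hangular, radialEnergy,
    ← angularPotential_mul_self, angularMomentum, ← circleNormSq]
  ring

lemma integral_mul_circleNormSq (hb : IsRadialProfile b R) (hu : ContDiff ℝ 1 u) {M : ℝ}
    (huM : ∀ x, ‖x‖ = M → u x = 0) (hM : 0 ≤ M) :
    ∫ r in (0 : ℝ)..M, b r * r * circleNormSq (polarFun u r) =
      -∫ r in (0 : ℝ)..M,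
        2 * radialFlux b r * (circleInner (polarFun u r) (radialDeriv u r)).re := by
  have hi : IntervalIntegrable (fun t => b t * t) volume 0 M :=
    hb.integrable_mul_id.intervalIntegrable
  have hN := hasDerivAt_circleNormSq_polarFun hu
  have hcont : Continuous fun r => (circleInner (polarFun u r) (radialDeriv u r)).re :=
    Complex.continuous_re.comp (continuous_circleInner (continuous_polarFun hu.continuous)
      (continuous_radialDeriv hu))
  have hN1 : ContDiff ℝ 1 fun r => circleNormSq (polarFun u r) := by
    refine contDiff_one_iff_deriv.2 ⟨fun r => (hN r).differentiableAt, ?_⟩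
    rw [funext fun r => (hN r).deriv]
    exact hcont.const_mul 2
  have hparts := AbsolutelyContinuousOnInterval.integral_mul_deriv_eq_deriv_mul
    (hi.absolutelyContinuousOnInterval_intervalIntegral left_mem_uIcc)
    (hN1.contDiffOn.absolutelyContinuousOnInterval (a := 0) (b := M))
  have hfield : ∫ r in (0 : ℝ)..M, deriv (fun x => ∫ t in (0 : ℝ)..x, b t * t) r *
      circleNormSq (polarFun u r) = ∫ r in (0 : ℝ)..M, b r * r * circleNormSq (polarFun u r) := by
    refine intervalIntegral.integral_congr_ae ?_
    filter_upwards [hi.ae_hasDerivAt_integral] with r hr hr'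
    rw [(hr (uIoc_subset_uIcc hr') 0 left_mem_uIcc).deriv]
  have hzero : polarFun u M = 0 := funext fun θ => huM _ (norm_smul_unitVec hM θ)
  have hboundary : circleNormSq (polarFun u M) = 0 := by simp [hzero, circleNormSq]
  simp only [hfield, (hN _).deriv, hboundary, intervalIntegral.integral_same] at hparts
  rw [← neg_eq_iff_eq_neg]
  simpa [radialFlux, mul_assoc, mul_left_comm] using hparts.symm

lemma integral_radialField_mul_norm_sq (hb : IsRadialProfile b R) (hu : ContDiff ℝ 1 u)
    (hs : HasCompactSupport u) {M : ℝ} (hM : 0 ≤ M) (huM : ∀ x, M ≤ ‖x‖ → x ∉ tsupport u) :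
    ∫ x, radialField b x * ‖u x‖ ^ 2 = -∫ r in (0 : ℝ)..M,
      2 * radialFlux b r * (circleInner (polarFun u r) (radialDeriv u r)).re := by
  have hzero (x : Plane) (hx : M ≤ ‖x‖) : u x = 0 := image_eq_zero_of_notMem_tsupport (huM x hx)
  rw [← hb.integral_mul_circleNormSq hu (fun x hx => hzero x hx.ge) hM]
  have hm : Measurable fun x => radialField b x * ‖u x‖ ^ 2 :=
    hb.measurable_radialField.mul (hu.continuous.norm.pow 2).measurable
  refine integral_polar_congr hm.stronglyMeasurable
    (hb.integrable_radialField_mul_norm_sq hu.continuous hs) hM (fun x hx => by simp [hzero x hx])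
    fun r hr => ?_
  simp only [radialField, norm_smul_unitVec hr.le, intervalIntegral.integral_const_mul,
    circleNormSq, polarFun]
  ring

lemma integral_kineticDensity_add (hb : IsRadialProfile b R) (hu : ContDiff ℝ 1 u)
    (hs : HasCompactSupport u) {M : ℝ} (hM : 0 ≤ M) (huM : ∀ x, M ≤ ‖x‖ → x ∉ tsupport u) :
    (∫ x, kineticDensity (radialField b) u (classicalGradient u) x) +
        ∫ x, radialField b x * ‖u x‖ ^ 2 =
      ∫ r in (0 : ℝ)..M, radialEnergy (angularPotential b) u r := by
  have hS : Continuous fun r => 2 * radialFlux b r *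
      (circleInner (polarFun u r) (radialDeriv u r)).re :=
    (hb.continuous_radialFlux.const_mul 2).mul (Complex.continuous_re.comp (continuous_circleInner
      (continuous_polarFun hu.continuous) (continuous_radialDeriv hu)))
  have hE := continuous_radialEnergy hb.continuous_angularPotential hu
  have hgrad := memLp_classicalGradient hu hs
  have hzero (x : Plane) (hx : M ≤ ‖x‖) :
      kineticDensity (radialField b) u (classicalGradient u) x = 0 := by
    simp [kineticDensity, magneticGradient, classicalGradient,
      fderiv_of_notMem_tsupport ℝ (huM x hx),
      image_eq_zero_of_notMem_tsupport (huM x hx)]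
  rw [integral_polar_congr (hb.measurable_kineticDensity hu.continuous.measurable fun j =>
      (continuous_classicalGradient hu j).measurable).stronglyMeasurable
      (hb.integrable_kineticDensity (hu.continuous.memLp_of_hasCompactSupport hs) hgrad) hM hzero
      fun r hr => hb.integral_kineticDensity_circle hu hr,
    hb.integral_radialField_mul_norm_sq hu hs hM huM,
    intervalIntegral.integral_add (hE.intervalIntegrable _ _) (hS.intervalIntegrable _ _),
    add_neg_cancel_right]

lemma integral_radialField_mul_norm_sq_le (hb : IsRadialProfile b R) (hu : ContDiff ℝ 1 u)
    (hs : HasCompactSupport u) :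
    ∫ x, radialField b x * ‖u x‖ ^ 2 ≤ potentialBound b *
      ∫ x, (‖u x‖ ^ 2 + ∑ j, ‖classicalGradient u j x‖ ^ 2) := by
  obtain ⟨M, hM, huM⟩ := exists_forall_le_norm_notMem_tsupport hs 0
  rw [hb.integral_radialField_mul_norm_sq hu hs hM huM, integral_norm_sq_add_gradient hu hs hM huM,
    ← intervalIntegral.integral_neg, ← intervalIntegral.integral_const_mul]
  have hU := continuous_polarFun hu.continuous
  have hUr := continuous_radialDeriv hu
  have hS := Complex.continuous_re.comp (continuous_circleInner hU hUr)
  have hN := continuous_circleNormSq hU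
  have hP := continuous_circleNormSq hUr
  have hT := continuous_circleNormSq (continuous_tangentialDeriv hu)
  have hΦ := hb.continuous_radialFlux
  refine intervalIntegral.integral_mono_on hM (Continuous.intervalIntegrable (by fun_prop) _ _)
    (Continuous.intervalIntegrable (by fun_prop) _ _) fun r hr => ?_
  have hΦr : radialFlux b r ≤ potentialBound b * r := by
    rw [← angularPotential_mul_self]
    exact mul_le_mul_of_nonneg_right (hb.angularPotential_le_potentialBound r) hr.1
  have hcross : -(2 * (circleInner (polarFun u r) (radialDeriv u r)).re) ≤
      circleNormSq (polarFun u r) + circleNormSq (radialDeriv u r) :=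
    neg_two_mul_re_circleInner_le (hU.uncurry_left r) (hUr.uncurry_left r)
  have htan := circleNormSq_nonneg (tangentialDeriv u r)
  calc -(2 * radialFlux b r * (circleInner (polarFun u r) (radialDeriv u r)).re)
      = radialFlux b r * -(2 * (circleInner (polarFun u r) (radialDeriv u r)).re) := by ring
    _ ≤ radialFlux b r * (circleNormSq (polarFun u r) + circleNormSq (radialDeriv u r) +
          circleNormSq (tangentialDeriv u r)) :=
        mul_le_mul_of_nonneg_left (by linarith) (hb.radialFlux_nonneg r)
    _ ≤ potentialBound b * r * (circleNormSq (polarFun u r) +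
          circleNormSq (radialDeriv u r) + circleNormSq (tangentialDeriv u r)) :=
        mul_le_mul_of_nonneg_right hΦr (add_nonneg (add_nonneg (circleNormSq_nonneg _)
          (circleNormSq_nonneg _)) (circleNormSq_nonneg _))
    _ = _ := mul_assoc _ _ _

theorem hardy_of_contDiff (hb : IsRadialProfile b R) (hu : ContDiff ℝ 2 u)
    (hs : HasCompactSupport u) :
    zeroModeWeight b R * distInt (flux (radialField b)) ^ 2 *
        ∫ x, ‖u x‖ ^ 2 / (R ^ 2 + ‖x‖ ^ 2) ≤
      (∫ x, kineticDensity (radialField b) u (classicalGradient u) x) +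
        ∫ x, radialField b x * ‖u x‖ ^ 2 := by
  have hu1 : ContDiff ℝ 1 u := hu.of_le one_le_two
  obtain ⟨M, hRM, huM⟩ := exists_forall_le_norm_notMem_tsupport hs R
  have hM := hb.pos.le.trans hRM
  have hzero (x : Plane) (hx : M ≤ ‖x‖) : u x = 0 := image_eq_zero_of_notMem_tsupport (huM x hx)
  have hE := continuous_radialEnergy hb.continuous_angularPotential hu1
  have hW : Continuous fun r => circleNormSq (polarFun u r) * (r / (R ^ 2 + r ^ 2)) :=
    (continuous_circleNormSq (continuous_polarFun hu.continuous)).mul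
      (continuous_hardyWeight hb.pos)
  have hdeficit := hb.integral_radialDeficit_nonneg hu hRM fun x hx => hzero x hx.ge
  simp only [radialDeficit] at hdeficit
  rw [intervalIntegral.integral_sub (hE.intervalIntegrable _ _)
    ((hW.const_mul _).intervalIntegrable _ _), intervalIntegral.integral_const_mul] at hdeficit
  rw [hb.integral_kineticDensity_add hu1 hs hM huM,
    integral_hardyWeight hb.pos.ne' hu.continuous hs hM hzero]
  exact sub_nonneg.1 hdeficit

end IsRadialProfile

/-! ### Density of test functions in `H¹` -/

open scoped SchwartzMap Laplacian LineDeriv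

/-- Smooth cut-off functions, equal to `1` on the ball of radius `n + 1` and to `0` outside the
ball of radius `2 (n + 1)`. -/
noncomputable def cutoff (n : ℕ) (x : Plane) : ℝ :=
  (⟨1, 2, one_pos, one_lt_two⟩ : ContDiffBump (0 : Plane)) (((n : ℝ) + 1)⁻¹ • x)

lemma contDiff_cutoff (n : ℕ) : ContDiff ℝ ∞ (cutoff n) :=
  (ContDiffBump.contDiff _).comp (contDiff_const_smul _)

lemma hasCompactSupport_cutoff (n : ℕ) : HasCompactSupport (cutoff n) :=
  (ContDiffBump.hasCompactSupport _).comp_homeomorph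
    (Homeomorph.smulOfNeZero ((n : ℝ) + 1)⁻¹ (by positivity))

lemma continuous_partialDeriv {f : Plane → ℝ} (hf : ContDiff ℝ 1 f) (j : Fin 2) :
    Continuous (partialDeriv j f) :=
  (hf.continuous_fderiv one_ne_zero).clm_apply continuous_const

lemma hasCompactSupport_partialDeriv {f : Plane → ℝ} (hf : HasCompactSupport f) (j : Fin 2) :
    HasCompactSupport (partialDeriv j f) :=
  hf.fderiv_apply ℝ _

lemma memLp_partialDeriv {f : Plane → ℝ} (hf : ContDiff ℝ 1 f) (hs : HasCompactSupport f)
    (j : Fin 2) : MemLp (partialDeriv j f) 2 :=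
  (continuous_partialDeriv hf j).memLp_of_hasCompactSupport (hasCompactSupport_partialDeriv hs j)

lemma tendsto_inv_natCast_add_one : Tendsto (fun n : ℕ => ((n : ℝ) + 1)⁻¹) atTop (𝓝 0) := by
  simpa only [one_div] using tendsto_one_div_add_atTop_nhds_zero_nat (𝕜 := ℝ)

lemma tendsto_cutoff (x : Plane) : Tendsto (fun n => cutoff n x) atTop (𝓝 1) := by
  have h : Tendsto (fun n : ℕ => ((n : ℝ) + 1)⁻¹ • x) atTop (𝓝 0) := by
    simpa only [zero_smul] using tendsto_inv_natCast_add_one.smul_const x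
  let χ : ContDiffBump (0 : Plane) := ⟨1, 2, one_pos, one_lt_two⟩
  have hχ := (χ.continuous.tendsto 0).comp h
  rwa [χ.one_of_mem_closedBall (Metric.mem_closedBall_self zero_le_one)] at hχ

lemma norm_cutoff_le_one (n : ℕ) (x : Plane) : ‖cutoff n x‖ ≤ 1 := by
  rw [cutoff, Real.norm_of_nonneg (ContDiffBump.nonneg _)]
  exact ContDiffBump.le_one _

lemma partialDeriv_cutoff (n : ℕ) (j : Fin 2) (x : Plane) :
    partialDeriv j (cutoff n) x = ((n : ℝ) + 1)⁻¹ *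
      partialDeriv j (⟨1, 2, one_pos, one_lt_two⟩ : ContDiffBump (0 : Plane))
        (((n : ℝ) + 1)⁻¹ • x) := by
  let χ : ContDiffBump (0 : Plane) := ⟨1, 2, one_pos, one_lt_two⟩
  change fderiv ℝ (fun y => χ (((n : ℝ) + 1)⁻¹ • y)) x _ = _
  rw [fderiv_comp_smul]
  rfl

lemma exists_abs_partialDeriv_cutoff_le : ∃ C, ∀ n j x,
    |partialDeriv j (cutoff n) x| ≤ ((n : ℝ) + 1)⁻¹ * C := by
  let χ : ContDiffBump (0 : Plane) := ⟨1, 2, one_pos, one_lt_two⟩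
  choose C hC using fun j => (hasCompactSupport_partialDeriv χ.hasCompactSupport
    j).exists_bound_of_continuous (continuous_partialDeriv χ.contDiff j)
  refine ⟨max (C 0) (C 1), fun n j x => ?_⟩
  rw [partialDeriv_cutoff, abs_mul, abs_of_pos (by positivity)]
  refine mul_le_mul_of_nonneg_left ((hC j _).trans ?_) (by positivity)
  fin_cases j
  exacts [le_max_left _ _, le_max_right _ _]

lemma tendsto_integral_cutoff_smul {F : Plane → ℂ} (hF : Integrable F) :
    Tendsto (fun n => ∫ x, cutoff n x • F x) atTop (𝓝 (∫ x, F x)) := by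
  refine tendsto_integral_of_dominated_convergence (fun x => ‖F x‖)
    (fun n => (contDiff_cutoff n).continuous.aestronglyMeasurable.smul hF.1) hF.norm
    (fun n => .of_forall fun x => ?_) (.of_forall fun x => ?_)
  · rw [norm_smul]
    exact mul_le_of_le_one_left (norm_nonneg _) (norm_cutoff_le_one n x)
  · simpa only [one_smul] using (tendsto_cutoff x).smul_const (F x)

lemma tendsto_integral_partialDeriv_cutoff_smul {F : Plane → ℂ} (hF : Integrable F) (j : Fin 2) :
    Tendsto (fun n => ∫ x, partialDeriv j (cutoff n) x • F x) atTop (𝓝 0) := by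
  obtain ⟨C, hC⟩ := exists_abs_partialDeriv_cutoff_le
  have hlim : Tendsto (fun n : ℕ => ((n : ℝ) + 1)⁻¹ * C * ∫ x, ‖F x‖) atTop (𝓝 0) := by
    simpa only [zero_mul] using (tendsto_inv_natCast_add_one.mul_const C).mul_const _
  refine squeeze_zero_norm (fun n => ?_) hlim
  rw [← integral_const_mul]
  refine norm_integral_le_of_norm_le (hF.norm.const_mul _) (.of_forall fun x => ?_)
  rw [norm_smul]
  exact mul_le_mul_of_nonneg_right (hC n j x) (norm_nonneg _)

lemma partialDeriv_mul {f g : Plane → ℝ} (hf : Differentiable ℝ f) (hg : Differentiable ℝ g)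
    (j : Fin 2) (x : Plane) :
    partialDeriv j (fun x => f x * g x) x =
      f x * partialDeriv j g x + partialDeriv j f x * g x := by
  simp only [partialDeriv, fderiv_fun_mul (hf x) (hg x), add_apply, smul_apply, smul_eq_mul,
    mul_comm (g x)]

/-- The weak divergence of the vector field `c` is `a`, tested in a single integral. -/
def HasWeakDivergence (c : Fin 2 → Plane → ℂ) (a : Plane → ℂ) : Prop :=
  ∀ φ : Plane → ℝ, ContDiff ℝ ∞ φ → HasCompactSupport φ →
    ∫ x, (φ x • a x + ∑ j, partialDeriv j φ x • c j x) = 0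

section WeakDivergence

variable {a : Plane → ℂ} {c : Fin 2 → Plane → ℂ}

lemma integrable_smul_of_memLp_two {f : Plane → ℝ} {u : Plane → ℂ} (hf : MemLp f 2)
    (hu : MemLp u 2) : Integrable fun x => f x • u x :=
  memLp_one_iff_integrable.1 (hu.smul hf)

lemma integrable_smul_add_sum_smul (ha : MemLp a 2) (hc : ∀ j, MemLp (c j) 2) {f : Plane → ℝ}
    {g : Fin 2 → Plane → ℝ} (hf : MemLp f 2) (hg : ∀ j, MemLp (g j) 2) :
    Integrable fun x => f x • a x + ∑ j, g j x • c j x :=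
  (integrable_smul_of_memLp_two hf ha).add
    (integrable_finsetSum _ fun j _ => integrable_smul_of_memLp_two (hg j) (hc j))

lemma HasWeakDivergence.integral_eq_zero (h : HasWeakDivergence c a) (ha : MemLp a 2)
    (hc : ∀ j, MemLp (c j) 2) {f : Plane → ℝ} (hf : ContDiff ℝ ∞ f) (hf2 : MemLp f 2)
    (hf2' : ∀ j, MemLp (partialDeriv j f) 2) :
    ∫ x, (f x • a x + ∑ j, partialDeriv j f x • c j x) = 0 := by
  have hfc (j : Fin 2) := integrable_smul_of_memLp_two hf2 (hc j)
  have hF := integrable_smul_add_sum_smul ha hc hf2 hf2'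
  have hχ (n : ℕ) := (contDiff_cutoff n).continuous
  have hχF (n : ℕ) : Integrable fun x =>
      cutoff n x • (f x • a x + ∑ j, partialDeriv j f x • c j x) :=
    hF.bdd_smul 1 (hχ n).aestronglyMeasurable (.of_forall (norm_cutoff_le_one n))
  have hχ' (n : ℕ) (j : Fin 2) := continuous_partialDeriv
    ((contDiff_cutoff n).of_le (by simp)) j
  have hχfc (n : ℕ) (j : Fin 2) :
      Integrable fun x => partialDeriv j (cutoff n) x • f x • c j x := by
    obtain ⟨C, hC⟩ := (hasCompactSupport_partialDeriv (hasCompactSupport_cutoff n)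
      j).exists_bound_of_continuous (hχ' n j)
    exact (hfc j).bdd_smul C (hχ' n j).aestronglyMeasurable (.of_forall hC)
  have hsplit (n : ℕ) :
      (∫ x, cutoff n x • (f x • a x + ∑ j, partialDeriv j f x • c j x)) +
        ∑ j, ∫ x, partialDeriv j (cutoff n) x • f x • c j x = 0 := by
    rw [← integral_finsetSum _ fun j _ => hχfc n j,
      ← integral_add (hχF n) (integrable_finsetSum _ fun j _ => hχfc n j),
      ← h _ ((contDiff_cutoff n).mul hf) (hasCompactSupport_cutoff n).mul_right]
    simp only [partialDeriv_mul ((contDiff_cutoff n).differentiable (by simp))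
      (hf.differentiable (by simp)), add_smul, mul_smul, smul_add, Finset.smul_sum,
      Finset.sum_add_distrib, add_assoc]
  have hlim := (tendsto_integral_cutoff_smul hF).add (tendsto_finsetSum Finset.univ fun j _ =>
    tendsto_integral_partialDeriv_cutoff_smul (hfc j) j)
  simp only [hsplit, Finset.sum_const_zero, add_zero] at hlim
  exact tendsto_nhds_unique hlim tendsto_const_nhds

end WeakDivergence

section SubLaplacian

variable {E F : Type*} [NormedAddCommGroup E] [InnerProductSpace ℝ E] [FiniteDimensional ℝ E]
  [MeasurableSpace E] [BorelSpace E] [NormedAddCommGroup F] [NormedSpace ℂ F]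

lemma fourierMultiplierCLM_add {g₁ g₂ : E → ℝ} (hg₁ : g₁.HasTemperateGrowth)
    (hg₂ : g₂.HasTemperateGrowth) (f : 𝓢(E, F)) :
    SchwartzMap.fourierMultiplierCLM F (g₁ + g₂) f =
      SchwartzMap.fourierMultiplierCLM F g₁ f + SchwartzMap.fourierMultiplierCLM F g₂ f := by
  simp only [SchwartzMap.fourierMultiplierCLM_apply, SchwartzMap.smulLeftCLM_add hg₁ hg₂,
    add_apply, FourierTransform.fourierInv_add]

lemma sub_laplacian_eq_fourierMultiplierCLM [CompleteSpace F] (ψ : 𝓢(E, F)) :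
    ψ - Δ ψ = SchwartzMap.fourierMultiplierCLM F (fun x => 1 + (2 * π) ^ 2 * ‖x‖ ^ 2) ψ := by
  have hsq := Function.hasTemperateGrowth_norm_sq E
  have hsq' : Function.HasTemperateGrowth ((2 * π) ^ 2 • fun x : E => ‖x‖ ^ 2) :=
    (Function.HasTemperateGrowth.const ((2 * π) ^ 2)).mul hsq
  rw [show (fun x : E => 1 + (2 * π) ^ 2 * ‖x‖ ^ 2) =
      (fun _ => 1) + (2 * π) ^ 2 • fun x => ‖x‖ ^ 2 from rfl,
    fourierMultiplierCLM_add (.const 1) hsq', SchwartzMap.fourierMultiplierCLM_const,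
    SchwartzMap.fourierMultiplierCLM_smul hsq, SchwartzMap.laplacian_eq_fourierMultiplierCLM]
  simp only [one_smul, ContinuousLinearMap.id_apply, smul_apply, neg_smul, sub_neg_eq_add]

theorem surjective_sub_laplacian [CompleteSpace F] :
    Function.Surjective fun ψ : 𝓢(E, F) => ψ - Δ ψ := by
  intro η
  let symbol : E → ℝ := fun x => 1 + (2 * π) ^ 2 * ‖x‖ ^ 2
  have hsymbol : symbol.HasTemperateGrowth := (Function.HasTemperateGrowth.const 1).add
    ((Function.HasTemperateGrowth.const ((2 * π) ^ 2)).mul (Function.hasTemperateGrowth_norm_sq E))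
  have hinv : (symbol⁻¹).HasTemperateGrowth := by
    have hlin : Function.HasTemperateGrowth fun x : E => (2 * π) • x :=
      ((2 * π) • ContinuousLinearMap.id ℝ E).hasTemperateGrowth
    have heq : symbol⁻¹ = (fun x => (1 + ‖x‖ ^ 2) ^ (-1 : ℝ)) ∘ fun x : E => (2 * π) • x := by
      funext x
      simp only [Function.comp_apply, Pi.inv_apply, symbol, Real.rpow_neg_one, norm_smul, mul_pow,
        Real.norm_eq_abs, sq_abs]
    rw [heq]
    exact (Function.hasTemperateGrowth_one_add_norm_sq_rpow E (-1)).comp hlin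
  have hmul : symbol * symbol⁻¹ = fun _ => 1 := by
    funext x
    exact mul_inv_cancel₀ (by positivity : symbol x ≠ 0)
  refine ⟨SchwartzMap.fourierMultiplierCLM F symbol⁻¹ η, ?_⟩
  simp only [sub_laplacian_eq_fourierMultiplierCLM]
  rw [SchwartzMap.fourierMultiplierCLM_fourierMultiplierCLM_apply hsymbol hinv, hmul,
    SchwartzMap.fourierMultiplierCLM_const, one_smul, ContinuousLinearMap.id_apply]

end SubLaplacian

section Postcomposition

variable {E F G : Type*} [NormedAddCommGroup E] [NormedAddCommGroup F] [NormedSpace ℝ F]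
  [NormedAddCommGroup G] [NormedSpace ℝ G]

lemma lineDerivOp_postcompCLM [NormedSpace ℝ E] (L : F →L[ℝ] G) (m : E) (f : 𝓢(E, F)) :
    ∂_{m} (SchwartzMap.postcompCLM L f) = SchwartzMap.postcompCLM L (∂_{m} f) := by
  ext x
  rw [SchwartzMap.postcompCLM_apply, SchwartzMap.lineDerivOp_apply_eq_fderiv,
    SchwartzMap.lineDerivOp_apply_eq_fderiv]
  exact congrArg (· m) (L.hasFDerivAt.comp x f.differentiableAt.hasFDerivAt).fderiv

lemma laplacian_postcompCLM [InnerProductSpace ℝ E] [FiniteDimensional ℝ E] (L : F →L[ℝ] G)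
    (f : 𝓢(E, F)) :
    Δ (SchwartzMap.postcompCLM L f) = SchwartzMap.postcompCLM L (Δ f) := by
  simp only [SchwartzMap.laplacian_eq_sum (stdOrthonormalBasis ℝ E), lineDerivOp_postcompCLM,
    map_sum]

theorem surjective_sub_laplacian_real [InnerProductSpace ℝ E] [FiniteDimensional ℝ E]
    [MeasurableSpace E] [BorelSpace E] : Function.Surjective fun ψ : 𝓢(E, ℝ) => ψ - Δ ψ := by
  intro η
  obtain ⟨ψ, hψ⟩ := surjective_sub_laplacian (SchwartzMap.postcompCLM Complex.ofRealCLM η)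
  refine ⟨SchwartzMap.postcompCLM Complex.reCLM ψ, ?_⟩
  simp only [laplacian_postcompCLM, ← map_sub] at hψ ⊢
  rw [hψ]
  rfl

end Postcomposition

lemma partialDeriv_schwartz (j : Fin 2) (ψ : 𝓢(Plane, ℝ)) :
    partialDeriv j ψ = ∂_{EuclideanSpace.single j (1 : ℝ)} ψ :=
  funext fun x => (SchwartzMap.lineDerivOp_apply_eq_fderiv _ ψ x).symm

lemma laplacian_apply_eq_sum_partialDeriv (ψ : 𝓢(Plane, ℝ)) (x : Plane) :
    Δ ψ x = ∑ j, partialDeriv j (partialDeriv j ψ) x := by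
  simp only [SchwartzMap.laplacian_eq_sum (EuclideanSpace.basisFun (Fin 2) ℝ),
    EuclideanSpace.basisFun_apply, sum_apply, partialDeriv_schwartz]

lemma sum_smul_single_apply (f : Fin 2 → ℝ) (a : Plane → ℂ) (j : Fin 2) (x : Plane) :
    ∑ i, f i • (Pi.single j a : Fin 2 → Plane → ℂ) i x = f j • a x := by
  rw [Finset.sum_eq_single j (fun i _ hi => by rw [Pi.single_eq_of_ne hi, Pi.zero_apply, smul_zero])
    (by simp), Pi.single_eq_same]

lemma sum_single_apply_smul (f : Plane → ℝ) (z : Fin 2 → ℂ) (j : Fin 2) (x : Plane) :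
    ∑ i, (Pi.single j f : Fin 2 → Plane → ℝ) i x • z i = f x • z j := by
  rw [Finset.sum_eq_single j (fun i _ hi => by rw [Pi.single_eq_of_ne hi, Pi.zero_apply, zero_smul])
    (by simp), Pi.single_eq_same]

lemma memLp_single {E : Type*} [NormedAddCommGroup E] {a : Plane → E} (ha : MemLp a 2)
    (i j : Fin 2) : MemLp ((Pi.single i a : Fin 2 → Plane → E) j) 2 := by
  rw [Pi.single_apply]
  split_ifs
  exacts [ha, MemLp.zero]

section WeakDivergence

variable {a : Plane → ℂ} {c : Fin 2 → Plane → ℂ}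

lemma HasWeakDivergence.integral_schwartz_eq_zero (h : HasWeakDivergence c a) (ha : MemLp a 2)
    (hc : ∀ j, MemLp (c j) 2) (ψ : 𝓢(Plane, ℝ)) :
    ∫ x, (ψ x • a x + ∑ j, partialDeriv j ψ x • c j x) = 0 :=
  h.integral_eq_zero ha hc (ψ.smooth ⊤) (ψ.memLp 2 volume) fun j => by
    rw [partialDeriv_schwartz]
    exact SchwartzMap.memLp _ 2 volume

/-- A vector field which is both a weak gradient of `a` and has weak divergence `a` makes `a` a
square integrable solution of `Δ a = a`. -/
lemma HasWeakDivergence.ae_eq_zero (h : HasWeakDivergence c a) (ha : MemLp a 2)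
    (hc : ∀ j, MemLp (c j) 2) (hgrad : ∀ j, HasWeakDivergence (Pi.single j a) (c j)) :
    a =ᵐ[volume] 0 := by
  refine ae_eq_zero_of_integral_contDiff_smul_eq_zero (ha.locallyIntegrable one_le_two)
    fun φ hφ hφs => ?_
  obtain ⟨ψ, hψ⟩ := surjective_sub_laplacian_real (hφs.toSchwartzMap hφ)
  have hφψ (x : Plane) : φ x = ψ x - ∑ j, partialDeriv j (partialDeriv j ψ) x := by
    rw [← laplacian_apply_eq_sum_partialDeriv]
    exact (DFunLike.congr_fun hψ x).symm
  have hdiv := h.integral_schwartz_eq_zero ha hc ψ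
  have hgrad' (j : Fin 2) :
      ∫ x, (partialDeriv j ψ x • c j x + partialDeriv j (partialDeriv j ψ) x • a x) = 0 := by
    have := (hgrad j).integral_schwartz_eq_zero (hc j) (memLp_single ha j)
      (∂_{EuclideanSpace.single j (1 : ℝ)} ψ)
    simpa only [sum_smul_single_apply, ← partialDeriv_schwartz] using this
  have hsmul (ζ : 𝓢(Plane, ℝ)) {f : Plane → ℂ} (hf : MemLp f 2) : Integrable fun x => ζ x • f x :=
    integrable_smul_of_memLp_two (ζ.memLp 2 volume) hf
  have hi (j : Fin 2) : Integrable fun x =>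
      partialDeriv j ψ x • c j x + partialDeriv j (partialDeriv j ψ) x • a x := by
    simp only [partialDeriv_schwartz]
    exact (hsmul _ (hc j)).add (hsmul _ ha)
  have hi' : Integrable fun x => ψ x • a x + ∑ j, partialDeriv j ψ x • c j x := by
    simp only [partialDeriv_schwartz]
    exact (hsmul ψ ha).add (integrable_finsetSum _ fun j _ => hsmul _ (hc j))
  calc ∫ x, φ x • a x
      = ∫ x, (ψ x • a x + ∑ j, partialDeriv j ψ x • c j x - ∑ j,
          (partialDeriv j ψ x • c j x + partialDeriv j (partialDeriv j ψ) x • a x)) := by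
        simp only [hφψ, sub_smul, Finset.sum_smul, Finset.sum_add_distrib,
          ← sub_sub, add_sub_cancel_right]
    _ = 0 := by
        rw [integral_sub hi' (integrable_finsetSum _ fun j _ => hi j), hdiv,
          integral_finsetSum _ fun j _ => hi j, Finset.sum_eq_zero fun j _ => hgrad' j, sub_zero]

lemma HasWeakDivergence.ae_eq_zero_of_single {j : Fin 2} {b : Plane → ℂ}
    (h : HasWeakDivergence (Pi.single j a) b) (ha : a =ᵐ[volume] 0) (hb : MemLp b 2) :
    b =ᵐ[volume] 0 := by
  refine ae_eq_zero_of_integral_contDiff_smul_eq_zero (hb.locallyIntegrable one_le_two)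
    fun φ hφ hφs => ?_
  rw [← h φ hφ hφs]
  refine integral_congr_ae ?_
  filter_upwards [ha] with x hx
  rw [sum_smul_single_apply, hx, Pi.zero_apply, smul_zero, add_zero]

end WeakDivergence

lemma HasWeakGradient.hasWeakDivergence {u : Plane → ℂ} {g : Fin 2 → Plane → ℂ}
    (h : HasWeakGradient u g) (hu : MemLp u 2) (hg : ∀ j, MemLp (g j) 2) (j : Fin 2) :
    HasWeakDivergence (Pi.single j u) (g j) := by
  intro φ hφ hφs
  have hφ2 : MemLp φ 2 := hφ.continuous.memLp_of_hasCompactSupport hφs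
  simp only [sum_smul_single_apply]
  rw [integral_add (integrable_smul_of_memLp_two hφ2 (hg j))
    (integrable_smul_of_memLp_two (memLp_partialDeriv (hφ.of_le (by simp)) hφs j) hu),
    h j φ hφ hφs, add_neg_cancel]

lemma classicalGradient_add {u v : Plane → ℂ} (hu : Differentiable ℝ u) (hv : Differentiable ℝ v)
    (j : Fin 2) : classicalGradient (u + v) j = classicalGradient u j + classicalGradient v j := by
  funext x
  rw [classicalGradient, fderiv_add (hu x) (hv x)]
  rfl

lemma classicalGradient_const_smul {u : Plane → ℂ} (hu : Differentiable ℝ u) (c : ℂ) (j : Fin 2) :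
    classicalGradient (c • u) j = c • classicalGradient u j := by
  funext x
  rw [classicalGradient, fderiv_const_smul (hu x)]
  rfl

lemma classicalGradient_ofReal {φ : Plane → ℝ} (hφ : Differentiable ℝ φ) (j : Fin 2) :
    classicalGradient (fun x => (φ x : ℂ)) j = fun x => (partialDeriv j φ x : ℂ) :=
  funext fun x => congrArg (fun L : Plane →L[ℝ] ℂ => L (EuclideanSpace.single j (1 : ℝ)))
    (Complex.ofRealCLM.hasFDerivAt.comp x (hφ x).hasFDerivAt).fderiv

lemma hasWeakGradient_classicalGradient {u : Plane → ℂ} (hu : ContDiff ℝ 1 u) :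
    HasWeakGradient u (classicalGradient u) := by
  intro j φ hφ hφs
  have hφ' := continuous_partialDeriv (hφ.of_le (by simp)) j
  have h := integral_smul_fderiv_eq_neg_fderiv_smul_of_integrable (μ := volume) (f := φ) (g := u)
    (v := EuclideanSpace.single j (1 : ℝ))
    ((hφ'.smul hu.continuous).integrable_of_hasCompactSupport
      (hasCompactSupport_partialDeriv hφs j).smul_right)
    ((hφ.continuous.smul (continuous_classicalGradient hu j)).integrable_of_hasCompactSupport
      hφs.smul_right)
    ((hφ.continuous.smul hu.continuous).integrable_of_hasCompactSupport hφs.smul_right)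
    (fun x _ => hφ.differentiable (by simp) x) (fun x _ => hu.differentiable one_ne_zero x)
  exact (neg_eq_iff_eq_neg.2 h).symm

/-- The Hilbert space of triples `(u, v₀, v₁)` of square integrable functions, into which `H¹` is
embedded by `u ↦ (u, ∇u)`. -/
abbrev SobolevAmbient : Type := PiLp 2 fun _ : Fin 3 => Lp ℂ 2 (volume : Measure Plane)

/-- The element of `SobolevAmbient` given by a function and a vector field. -/
noncomputable def sobolevTriple {u : Plane → ℂ} {v : Fin 2 → Plane → ℂ} (hu : MemLp u 2)
    (hv : ∀ j, MemLp (v j) 2) : SobolevAmbient :=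
  WithLp.toLp 2 (Fin.cons (hu.toLp u) fun j => (hv j).toLp (v j))

lemma inner_toLp_ofReal {f : Plane → ℝ} (hf : MemLp (fun x => (f x : ℂ)) 2)
    (w : Lp ℂ 2 (volume : Measure Plane)) : inner ℂ (hf.toLp _) w = ∫ x, f x • w x := by
  rw [L2.inner_def]
  refine integral_congr_ae ?_
  filter_upwards [hf.coeFn_toLp] with x hx
  rw [hx, RCLike.inner_apply, Complex.conj_ofReal, mul_comm, Complex.real_smul]

lemma inner_sobolevTriple_ofReal {f : Plane → ℝ} {g : Fin 2 → Plane → ℝ} (hf : MemLp f 2)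
    (hg : ∀ j, MemLp (g j) 2) (z : SobolevAmbient) :
    inner ℂ (sobolevTriple hf.ofReal fun j => (hg j).ofReal) z =
      ∫ x, (f x • z 0 x + ∑ j : Fin 2, g j x • z j.succ x) := by
  have hi (j : Fin 2) := integrable_smul_of_memLp_two (hg j) (Lp.memLp (z j.succ))
  rw [PiLp.inner_apply, Fin.sum_univ_succ,
    integral_add (integrable_smul_of_memLp_two hf (Lp.memLp (z 0)))
      (integrable_finsetSum _ fun j _ => hi j), integral_finsetSum _ fun j _ => hi j,
    ← inner_toLp_ofReal (f := f) hf.ofReal]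
  simp only [← inner_toLp_ofReal (f := g _) (hg _).ofReal]
  rfl

/-- Smooth compactly supported functions, as a subspace of `SobolevAmbient`. -/
noncomputable def testSubmodule : Submodule ℂ SobolevAmbient where
  carrier := {z | ∃ φ : Plane → ℂ, ContDiff ℝ ∞ φ ∧ HasCompactSupport φ ∧
    z 0 =ᵐ[volume] φ ∧ ∀ j : Fin 2, z j.succ =ᵐ[volume] classicalGradient φ j}
  zero_mem' := by
    refine ⟨0, contDiff_const, HasCompactSupport.zero, Lp.coeFn_zero _ _ _, fun j => ?_⟩
    refine (Lp.coeFn_zero _ _ _).trans (ae_of_all _ fun x => ?_)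
    simp [classicalGradient]
  add_mem' := by
    rintro z w ⟨φ, hφ, hφs, hz, hz'⟩ ⟨χ, hχ, hχs, hw, hw'⟩
    refine ⟨φ + χ, hφ.add hχ, hφs.add hχs, (Lp.coeFn_add _ _).trans (hz.add hw), fun j => ?_⟩
    rw [classicalGradient_add (hφ.differentiable (by simp)) (hχ.differentiable (by simp))]
    exact (Lp.coeFn_add _ _).trans ((hz' j).add (hw' j))
  smul_mem' := by
    rintro c z ⟨φ, hφ, hφs, hz, hz'⟩
    refine ⟨c • φ, contDiff_const.smul hφ, hφs.smul_left,
      (Lp.coeFn_smul _ _).trans (hz.const_smul c), fun j => ?_⟩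
    rw [classicalGradient_const_smul (hφ.differentiable (by simp))]
    exact (Lp.coeFn_smul _ _).trans ((hz' j).const_smul c)

section DualTriple

variable {φ : Plane → ℝ}

/-- The triple whose inner product with `(u, v₀, v₁)` tests whether `vⱼ` is the weak `j`-th partial
derivative of `u`. -/
noncomputable def dualTriple (hφ : ContDiff ℝ ∞ φ) (hφs : HasCompactSupport φ) (j : Fin 2) :
    SobolevAmbient :=
  sobolevTriple (memLp_partialDeriv (hφ.of_le (by simp)) hφs j).ofReal fun i =>
    (memLp_single (hφ.continuous.memLp_of_hasCompactSupport hφs) j i).ofReal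

lemma inner_dualTriple (hφ : ContDiff ℝ ∞ φ) (hφs : HasCompactSupport φ) (j : Fin 2)
    (z : SobolevAmbient) :
    inner ℂ (dualTriple hφ hφs j) z = ∫ x, (partialDeriv j φ x • z 0 x + φ x • z j.succ x) := by
  rw [dualTriple, inner_sobolevTriple_ofReal (memLp_partialDeriv (hφ.of_le (by simp)) hφs j)
    (memLp_single (hφ.continuous.memLp_of_hasCompactSupport hφs) j)]
  simp only [sum_single_apply_smul]

end DualTriple

/-- The space `H¹`, as a closed subspace of `SobolevAmbient`. -/
noncomputable def sobolevSubmodule : Submodule ℂ SobolevAmbient :=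
  (Submodule.span ℂ {w | ∃ (φ : Plane → ℝ) (hφ : ContDiff ℝ ∞ φ) (hφs : HasCompactSupport φ)
    (j : Fin 2), w = dualTriple hφ hφs j})ᗮ

lemma mem_sobolevSubmodule {z : SobolevAmbient} :
    z ∈ sobolevSubmodule ↔ ∀ j, HasWeakDivergence (Pi.single j (z 0)) (z j.succ) := by
  have htest {φ : Plane → ℝ} (hφ : ContDiff ℝ ∞ φ) (hφs : HasCompactSupport φ) (j : Fin 2) :
      inner ℂ (dualTriple hφ hφs j) z = ∫ x, (φ x • z j.succ x +
        ∑ i, partialDeriv i φ x • (Pi.single j (z 0) : Fin 2 → Plane → ℂ) i x) := by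
    simp only [inner_dualTriple, sum_smul_single_apply, add_comm]
  rw [sobolevSubmodule, Submodule.mem_orthogonal]
  refine ⟨fun h j φ hφ hφs => ?_, fun h w hw => ?_⟩
  · rw [← htest hφ hφs]
    exact h _ (Submodule.subset_span ⟨φ, hφ, hφs, j, rfl⟩)
  · induction hw using Submodule.span_induction with
    | mem w hw =>
      obtain ⟨φ, hφ, hφs, j, rfl⟩ := hw
      rw [htest, h j φ hφ hφs]
    | zero => exact inner_zero_left _
    | add w w' _ _ hw hw' => rw [inner_add_left, hw, hw', add_zero]
    | smul c w _ hw => rw [inner_smul_left, hw, mul_zero]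

lemma HasWeakGradient.mem_sobolevSubmodule {u : Plane → ℂ} {g : Fin 2 → Plane → ℂ}
    (h : HasWeakGradient u g) (hu : MemLp u 2) (hg : ∀ j, MemLp (g j) 2) {z : SobolevAmbient}
    (hz : z 0 =ᵐ[volume] u) (hz' : ∀ j : Fin 2, z j.succ =ᵐ[volume] g j) :
    z ∈ sobolevSubmodule := by
  refine PauliHardy.mem_sobolevSubmodule.2 fun j φ hφ hφs => ?_
  rw [← h.hasWeakDivergence hu hg j φ hφ hφs]
  refine integral_congr_ae ?_
  filter_upwards [hz, hz' j] with x hx hx'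
  simp only [sum_smul_single_apply, hx, hx']

lemma hasWeakDivergence_of_mem_testSubmodule_orthogonal {z : SobolevAmbient}
    (hz : z ∈ testSubmoduleᗮ) : HasWeakDivergence (fun j : Fin 2 => z j.succ) (z 0) := by
  intro φ hφ hφs
  have hφ2 := hφ.continuous.memLp_of_hasCompactSupport (μ := volume) (p := 2) hφs
  have hφ2' := memLp_partialDeriv (hφ.of_le (by simp)) hφs
  rw [← inner_sobolevTriple_ofReal hφ2 hφ2']
  refine (Submodule.mem_orthogonal _ _).1 hz _ ⟨fun x => (φ x : ℂ),
    Complex.ofRealCLM.contDiff.comp hφ, hφs.comp_left Complex.ofReal_zero,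
    hφ2.ofReal.coeFn_toLp, fun j => ?_⟩
  rw [classicalGradient_ofReal (hφ.differentiable (by simp))]
  exact (hφ2' j).ofReal.coeFn_toLp

theorem topologicalClosure_testSubmodule :
    testSubmodule.topologicalClosure = sobolevSubmodule := by
  have hle : testSubmodule.topologicalClosure ≤ sobolevSubmodule := by
    refine Submodule.topologicalClosure_minimal _ ?_ (Submodule.isClosed_orthogonal _)
    rintro z ⟨φ, hφ, hφs, hz, hz'⟩
    have hφ1 : ContDiff ℝ 1 φ := hφ.of_le (by simp)
    exact (hasWeakGradient_classicalGradient hφ1).mem_sobolevSubmodule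
      (hφ.continuous.memLp_of_hasCompactSupport hφs) (memLp_classicalGradient hφ1 hφs) hz hz'
  have hcomplete : CompleteSpace testSubmodule.topologicalClosure :=
    (Submodule.isClosed_topologicalClosure _).completeSpace_coe
  have hbot : testSubmodule.topologicalClosureᗮ ⊓ sobolevSubmodule = ⊥ := by
    refine (Submodule.eq_bot_iff _).2 fun z hz => ?_
    rw [Submodule.orthogonal_closure] at hz
    have hgrad := mem_sobolevSubmodule.1 hz.2
    have hz0 := (hasWeakDivergence_of_mem_testSubmodule_orthogonal hz.1).ae_eq_zero
      (Lp.memLp _) (fun j => Lp.memLp _) hgrad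
    refine PiLp.ext fun i => Lp.ext (EventuallyEq.trans ?_ (Lp.coeFn_zero _ _ _).symm)
    exact Fin.cases hz0 (fun j => (hgrad j).ae_eq_zero_of_single hz0 (Lp.memLp _)) i
  rw [← Submodule.sup_orthogonal_inf_of_hasOrthogonalProjection hle, hbot, sup_bot_eq]

theorem exists_contDiff_tendsto {u : Plane → ℂ} {g : Fin 2 → Plane → ℂ} (hu : MemLp u 2)
    (hg : HasL2WeakGradient u g) : ∃ φ : ℕ → Plane → ℂ,
      (∀ n, ContDiff ℝ ∞ (φ n)) ∧ (∀ n, HasCompactSupport (φ n)) ∧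
      Tendsto (fun n => eLpNorm (φ n - u) 2 volume) atTop (𝓝 0) ∧
      ∀ j, Tendsto (fun n => eLpNorm (classicalGradient (φ n) j - g j) 2 volume) atTop (𝓝 0) := by
  have hmem : sobolevTriple hu hg.1 ∈ testSubmodule.topologicalClosure := by
    rw [topologicalClosure_testSubmodule]
    exact hg.2.mem_sobolevSubmodule hu hg.1 hu.coeFn_toLp fun j => (hg.1 j).coeFn_toLp
  obtain ⟨z, hz, hzlim⟩ := mem_closure_iff_seq_limit.1 hmem
  choose φ hφ hφs hzφ hzφ' using hz
  have hlim (i : Fin 3) := ((PiLp.continuous_apply 2 _ i).tendsto _).comp hzlim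
  refine ⟨φ, hφ, hφs, ?_, fun j => ?_⟩
  · exact ((Lp.tendsto_Lp_iff_tendsto_eLpNorm _ _ hu).1 (hlim 0)).congr fun n =>
      eLpNorm_congr_ae ((hzφ n).sub .rfl)
  · exact ((Lp.tendsto_Lp_iff_tendsto_eLpNorm _ _ (hg.1 j)).1 (hlim j.succ)).congr fun n =>
      eLpNorm_congr_ae ((hzφ' n j).sub .rfl)

section LpConvergence

variable {X E : Type*} [MeasurableSpace X] [NormedAddCommGroup E] {μ : Measure X}

lemma toReal_eLpNorm_two_sq {f : X → E} (hf : MemLp f 2 μ) :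
    (eLpNorm f 2 μ).toReal ^ 2 = ∫ x, ‖f x‖ ^ 2 ∂μ := by
  have h : 0 ≤ ∫ x, ‖f x‖ ^ 2 ∂μ := integral_nonneg fun x => by positivity
  rw [hf.eLpNorm_eq_integral_rpow_norm two_ne_zero ENNReal.ofNat_ne_top,
    ENNReal.toReal_ofReal (by positivity)]
  simp only [ENNReal.toReal_ofNat, Real.rpow_ofNat]
  rw [← one_div, ← Real.sqrt_eq_rpow, Real.sq_sqrt h]

lemma tendsto_integral_norm_sq {f : ℕ → X → E} {g : X → E} (hf : ∀ n, MemLp (f n) 2 μ)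
    (hg : MemLp g 2 μ) (h : Tendsto (fun n => eLpNorm (f n - g) 2 μ) atTop (𝓝 0)) :
    Tendsto (fun n => ∫ x, ‖f n x‖ ^ 2 ∂μ) atTop (𝓝 (∫ x, ‖g x‖ ^ 2 ∂μ)) := by
  have hnorm := ((Lp.tendsto_Lp_iff_tendsto_eLpNorm'' f hf g hg).2 h).norm.pow 2
  simpa only [Lp.norm_toLp, toReal_eLpNorm_two_sq (hf _), toReal_eLpNorm_two_sq hg] using hnorm

end LpConvergence

lemma tendsto_integral_hardyWeight {R : ℝ} (hR : 0 < R) {u : Plane → ℂ} {φ : ℕ → Plane → ℂ}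
    (hu : MemLp u 2) (hφ : ∀ n, MemLp (φ n) 2)
    (hφu : Tendsto (fun n => eLpNorm (φ n - u) 2 volume) atTop (𝓝 0)) :
    Tendsto (fun n => ∫ x, ‖φ n x‖ ^ 2 / (R ^ 2 + ‖x‖ ^ 2)) atTop
      (𝓝 (∫ x, ‖u x‖ ^ 2 / (R ^ 2 + ‖x‖ ^ 2))) := by
  set w : Plane → ℝ := fun x => (√(R ^ 2 + ‖x‖ ^ 2))⁻¹
  have hw_sq (v : ℂ) (x : Plane) : ‖v‖ ^ 2 / (R ^ 2 + ‖x‖ ^ 2) = ‖w x • v‖ ^ 2 := by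
    rw [norm_smul, mul_pow, Real.norm_eq_abs, sq_abs, inv_pow, Real.sq_sqrt (by positivity),
      inv_mul_eq_div]
  have hw_cont : Continuous w :=
    Continuous.inv₀ (by fun_prop) fun x => (Real.sqrt_pos.2 (by positivity)).ne'
  have hw_le (v : ℂ) (x : Plane) : ‖w x • v‖ ≤ R⁻¹ * ‖v‖ := by
    rw [norm_smul, Real.norm_eq_abs, abs_of_nonneg (inv_nonneg.2 (Real.sqrt_nonneg _))]
    gcongr
    exact Real.le_sqrt_of_sq_le (le_add_of_nonneg_right (sq_nonneg _))
  have hw_memLp {f : Plane → ℂ} (hf : MemLp f 2) : MemLp (fun x => w x • f x) 2 :=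
    hf.of_le_mul (hw_cont.aestronglyMeasurable.smul hf.1) (.of_forall fun x => hw_le (f x) x)
  simp only [hw_sq]
  refine tendsto_integral_norm_sq (fun n => hw_memLp (hφ n)) (hw_memLp hu) ?_
  have hlim := ENNReal.Tendsto.const_mul hφu (.inr (ENNReal.ofReal_ne_top (r := R⁻¹)))
  rw [mul_zero] at hlim
  refine tendsto_of_tendsto_of_tendsto_of_le_of_le tendsto_const_nhds hlim (fun _ => zero_le)
    fun n => eLpNorm_le_mul_eLpNorm_of_ae_le_mul (.of_forall fun x => ?_) 2
  simp only [Pi.sub_apply, ← smul_sub]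
  exact hw_le _ x

lemma magneticGradient_sub (B : Plane → ℝ) (u v : Plane → ℂ) (g k : Fin 2 → Plane → ℂ)
    (j : Fin 2) :
    magneticGradient B (u - v) (g - k) j = magneticGradient B u g j - magneticGradient B v k j := by
  funext x
  simp only [magneticGradient, Pi.sub_apply]
  ring

lemma HasL2WeakGradient.sub {u v : Plane → ℂ} {g k : Fin 2 → Plane → ℂ} (hu : MemLp u 2)
    (hv : MemLp v 2) (hg : HasL2WeakGradient u g) (hk : HasL2WeakGradient v k) :
    HasL2WeakGradient (u - v) (g - k) := by
  refine ⟨fun j => (hg.1 j).sub (hk.1 j), fun j φ hφ hφs => ?_⟩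
  have hφ2 : MemLp φ 2 := hφ.continuous.memLp_of_hasCompactSupport hφs
  have hφ2' := memLp_partialDeriv (hφ.of_le (by simp)) hφs j
  simp only [Pi.sub_apply, smul_sub]
  rw [integral_sub (integrable_smul_of_memLp_two hφ2' hu) (integrable_smul_of_memLp_two hφ2' hv),
    integral_sub (integrable_smul_of_memLp_two hφ2 (hg.1 j))
      (integrable_smul_of_memLp_two hφ2 (hk.1 j)), hg.2 j φ hφ hφs, hk.2 j φ hφ hφs]
  abel

/-- The measure with density `B`, so that `∫ B |u|²` is the squared norm of `u` in its `L²`. -/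
noncomputable def fieldMeasure (B : Plane → ℝ) : Measure Plane :=
  volume.withDensity fun x => ENNReal.ofReal (B x)

lemma fieldMeasure_absolutelyContinuous (B : Plane → ℝ) : fieldMeasure B ≪ volume :=
  withDensity_absolutelyContinuous _ _

/-- The graph norm `‖u‖₂ + ‖g₀‖₂ + ‖g₁‖₂`; for `g = ∇u` it is equivalent to the `H¹` norm of
`u`. -/
noncomputable def sobolevNorm (u : Plane → ℂ) (g : Fin 2 → Plane → ℂ) : ℝ≥0∞ :=
  eLpNorm u 2 volume + ∑ j, eLpNorm (g j) 2 volume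

section SobolevNorm

variable {u : Plane → ℂ} {g : Fin 2 → Plane → ℂ}

lemma sobolevNorm_ne_top (hu : MemLp u 2) (hg : ∀ j, MemLp (g j) 2) : sobolevNorm u g ≠ ⊤ :=
  ENNReal.add_ne_top.2 ⟨hu.2.ne, ENNReal.sum_ne_top.2 fun j _ => (hg j).2.ne⟩

lemma sobolevNorm_le_add {v : Plane → ℂ} {k : Fin 2 → Plane → ℂ} (hu : MemLp u 2)
    (hv : MemLp v 2) (hg : ∀ j, MemLp (g j) 2) (hk : ∀ j, MemLp (k j) 2) :
    sobolevNorm u g ≤ sobolevNorm (u - v) (g - k) + sobolevNorm v k := by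
  have htri {f h : Plane → ℂ} (hf : MemLp f 2) (hh : MemLp h 2) :
      eLpNorm f 2 volume ≤ eLpNorm (f - h) 2 volume + eLpNorm h 2 volume := by
    simpa using eLpNorm_add_le (hf.sub hh).1 hh.1 one_le_two
  calc sobolevNorm u g
      ≤ (eLpNorm (u - v) 2 volume + eLpNorm v 2 volume) +
          ∑ j, (eLpNorm (g j - k j) 2 volume + eLpNorm (k j) 2 volume) :=
        add_le_add (htri hu hv) (Finset.sum_le_sum fun j _ => htri (hg j) (hk j))
    _ = sobolevNorm (u - v) (g - k) + sobolevNorm v k := by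
        rw [Finset.sum_add_distrib, add_add_add_comm]
        rfl

lemma integral_norm_sq_add_le_sobolevNorm_sq (hu : MemLp u 2) (hg : ∀ j, MemLp (g j) 2) :
    ∫ x, (‖u x‖ ^ 2 + ∑ j, ‖g j x‖ ^ 2) ≤ (sobolevNorm u g).toReal ^ 2 := by
  have hgi (j : Fin 2) := (hg j).integrable_norm_pow two_ne_zero
  rw [integral_add (hu.integrable_norm_pow two_ne_zero) (integrable_finsetSum _ fun j _ => hgi j),
    integral_finsetSum _ fun j _ => hgi j, sobolevNorm,
    ENNReal.toReal_add hu.2.ne (ENNReal.sum_ne_top.2 fun j _ => (hg j).2.ne),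
    ENNReal.toReal_sum fun j _ => (hg j).2.ne, ← toReal_eLpNorm_two_sq hu]
  simp only [← toReal_eLpNorm_two_sq (hg _)]
  calc (eLpNorm u 2 volume).toReal ^ 2 + ∑ j, (eLpNorm (g j) 2 volume).toReal ^ 2
      ≤ (eLpNorm u 2 volume).toReal ^ 2 + (∑ j, (eLpNorm (g j) 2 volume).toReal) ^ 2 := by
        gcongr
        exact Finset.sum_sq_le_sq_sum_of_nonneg fun j _ => ENNReal.toReal_nonneg
    _ ≤ ((eLpNorm u 2 volume).toReal + ∑ j, (eLpNorm (g j) 2 volume).toReal) ^ 2 :=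
        pow_add_pow_le ENNReal.toReal_nonneg
          (Finset.sum_nonneg fun j _ => ENNReal.toReal_nonneg) two_ne_zero

lemma tendsto_sobolevNorm {φ : ℕ → Plane → ℂ} {γ : ℕ → Fin 2 → Plane → ℂ}
    (hφu : Tendsto (fun n => eLpNorm (φ n - u) 2 volume) atTop (𝓝 0))
    (hγg : ∀ j, Tendsto (fun n => eLpNorm (γ n j - g j) 2 volume) atTop (𝓝 0)) :
    Tendsto (fun n => sobolevNorm (φ n - u) (γ n - g)) atTop (𝓝 0) := by
  have hsum := hφu.add (tendsto_finsetSum Finset.univ fun j _ => hγg j)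
  rwa [Finset.sum_const_zero, add_zero] at hsum

end SobolevNorm

namespace IsRadialProfile

variable {b : ℝ → ℝ} {R : ℝ}

lemma integrable_fieldMeasure_iff (hb : IsRadialProfile b R) {f : Plane → ℝ} :
    Integrable f (fieldMeasure (radialField b)) ↔ Integrable fun x => radialField b x * f x := by
  rw [fieldMeasure, integrable_withDensity_iff_integrable_smul'
    hb.measurable_radialField.ennreal_ofReal (.of_forall fun _ => ENNReal.ofReal_lt_top)]
  simp only [smul_eq_mul, radialField, ENNReal.toReal_ofReal (hb.nonneg _)]

lemma integral_fieldMeasure (hb : IsRadialProfile b R) (f : Plane → ℝ) :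
    ∫ x, f x ∂(fieldMeasure (radialField b)) = ∫ x, radialField b x * f x := by
  rw [fieldMeasure, integral_withDensity_eq_integral_toReal_smul
    hb.measurable_radialField.ennreal_ofReal (.of_forall fun _ => ENNReal.ofReal_lt_top)]
  simp only [smul_eq_mul, radialField, ENNReal.toReal_ofReal (hb.nonneg _)]

lemma memLp_fieldMeasure (hb : IsRadialProfile b R) {u : Plane → ℂ} (hu : Continuous u)
    (hs : HasCompactSupport u) : MemLp u 2 (fieldMeasure (radialField b)) :=
  (memLp_two_iff_integrable_sq_norm hu.aestronglyMeasurable).2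
    (hb.integrable_fieldMeasure_iff.2 (hb.integrable_radialField_mul_norm_sq hu hs))

lemma eLpNorm_fieldMeasure_le_of_contDiff (hb : IsRadialProfile b R) {u : Plane → ℂ}
    (hu : ContDiff ℝ 1 u) (hs : HasCompactSupport u) :
    eLpNorm u 2 (fieldMeasure (radialField b)) ≤
      ENNReal.ofReal √(potentialBound b) * sobolevNorm u (classicalGradient u) := by
  have hu2 : MemLp u 2 := hu.continuous.memLp_of_hasCompactSupport hs
  have hg2 := memLp_classicalGradient hu hs
  have hν := hb.memLp_fieldMeasure hu.continuous hs
  refine (ENNReal.toReal_le_toReal hν.2.ne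
    (ENNReal.mul_ne_top ENNReal.ofReal_ne_top (sobolevNorm_ne_top hu2 hg2))).1 ?_
  rw [ENNReal.toReal_mul, ENNReal.toReal_ofReal (Real.sqrt_nonneg _)]
  refine le_of_sq_le_sq ?_ (by positivity)
  rw [mul_pow, Real.sq_sqrt (potentialBound_nonneg b), toReal_eLpNorm_two_sq hν,
    hb.integral_fieldMeasure]
  exact (hb.integral_radialField_mul_norm_sq_le hu hs).trans (mul_le_mul_of_nonneg_left
    (integral_norm_sq_add_le_sobolevNorm_sq hu2 hg2) (potentialBound_nonneg b))

lemma eLpNorm_fieldMeasure_le (hb : IsRadialProfile b R) {u : Plane → ℂ}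
    {g : Fin 2 → Plane → ℂ} (hu : MemLp u 2) (hg : HasL2WeakGradient u g) :
    eLpNorm u 2 (fieldMeasure (radialField b)) ≤
      ENNReal.ofReal √(potentialBound b) * sobolevNorm u g := by
  obtain ⟨φ, hφ, hφs, hφu, hφg⟩ := exists_contDiff_tendsto hu hg
  have hφ1 (n : ℕ) : ContDiff ℝ 1 (φ n) := (hφ n).of_le (by simp)
  set c : ℝ≥0∞ := ENNReal.ofReal √(potentialBound b)
  have hc : c ≠ ⊤ := ENNReal.ofReal_ne_top
  obtain ⟨s, hs, hsu⟩ := (tendstoInMeasure_of_tendsto_eLpNorm two_ne_zero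
    (fun n => (hφ n).continuous.aestronglyMeasurable) hu.1 hφu).exists_seq_tendsto_ae
  set e : ℕ → ℝ≥0∞ := fun n => sobolevNorm (φ n - u) (classicalGradient (φ n) - g)
  have he : Tendsto (fun k => c * (e (s k) + sobolevNorm u g)) atTop
      (𝓝 (c * (0 + sobolevNorm u g))) :=
    ENNReal.Tendsto.const_mul
      (((tendsto_sobolevNorm hφu hφg).comp hs.tendsto_atTop).add_const _) (.inr hc)
  calc eLpNorm u 2 (fieldMeasure (radialField b))
      ≤ liminf (fun k => eLpNorm (φ (s k)) 2 (fieldMeasure (radialField b))) atTop :=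
        Lp.eLpNorm_lim_le_liminf_eLpNorm
          (fun k => (hφ (s k)).continuous.aestronglyMeasurable) u
          ((fieldMeasure_absolutelyContinuous _).ae_le hsu)
    _ ≤ liminf (fun k => c * (e (s k) + sobolevNorm u g)) atTop :=
        liminf_le_liminf (.of_forall fun k =>
          (hb.eLpNorm_fieldMeasure_le_of_contDiff (hφ1 _) (hφs _)).trans (mul_le_mul_right
            (sobolevNorm_le_add ((hφ _).continuous.memLp_of_hasCompactSupport (hφs _)) hu
              (memLp_classicalGradient (hφ1 _) (hφs _)) hg.1) c))
    _ = c * sobolevNorm u g := by rw [he.liminf_eq, zero_add]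

lemma memLp_fieldMeasure_of_hasL2WeakGradient (hb : IsRadialProfile b R) {u : Plane → ℂ}
    {g : Fin 2 → Plane → ℂ} (hu : MemLp u 2) (hg : HasL2WeakGradient u g) :
    MemLp u 2 (fieldMeasure (radialField b)) :=
  ⟨hu.1.mono_ac (fieldMeasure_absolutelyContinuous _), (hb.eLpNorm_fieldMeasure_le hu hg).trans_lt
    (ENNReal.mul_lt_top ENNReal.ofReal_lt_top (sobolevNorm_ne_top hu hg.1).lt_top)⟩

lemma integrable_radialField_mul_norm_sq_of_hasL2WeakGradient (hb : IsRadialProfile b R)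
    {u : Plane → ℂ} {g : Fin 2 → Plane → ℂ} (hu : MemLp u 2) (hg : HasL2WeakGradient u g) :
    Integrable fun x => radialField b x * ‖u x‖ ^ 2 :=
  hb.integrable_fieldMeasure_iff.1
    ((hb.memLp_fieldMeasure_of_hasL2WeakGradient hu hg).integrable_norm_pow two_ne_zero)

section Limits

variable {u : Plane → ℂ} {g : Fin 2 → Plane → ℂ} {φ : ℕ → Plane → ℂ} {γ : ℕ → Fin 2 → Plane → ℂ}

lemma tendsto_integral_radialField_mul_norm_sq (hb : IsRadialProfile b R) (hu : MemLp u 2)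
    (hg : HasL2WeakGradient u g) (hφ : ∀ n, MemLp (φ n) 2)
    (hγ : ∀ n, HasL2WeakGradient (φ n) (γ n))
    (hφu : Tendsto (fun n => eLpNorm (φ n - u) 2 volume) atTop (𝓝 0))
    (hγg : ∀ j, Tendsto (fun n => eLpNorm (γ n j - g j) 2 volume) atTop (𝓝 0)) :
    Tendsto (fun n => ∫ x, radialField b x * ‖φ n x‖ ^ 2) atTop
      (𝓝 (∫ x, radialField b x * ‖u x‖ ^ 2)) := by
  have hlim := ENNReal.Tendsto.const_mul (tendsto_sobolevNorm hφu hγg)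
    (.inr (ENNReal.ofReal_ne_top (r := √(potentialBound b))))
  rw [mul_zero] at hlim
  simp only [← hb.integral_fieldMeasure]
  exact tendsto_integral_norm_sq
    (fun n => hb.memLp_fieldMeasure_of_hasL2WeakGradient (hφ n) (hγ n))
    (hb.memLp_fieldMeasure_of_hasL2WeakGradient hu hg)
    (tendsto_of_tendsto_of_tendsto_of_le_of_le tendsto_const_nhds hlim (fun _ => zero_le)
      fun n => hb.eLpNorm_fieldMeasure_le ((hφ n).sub hu) ((hγ n).sub (hφ n) hu hg))

lemma integral_kineticDensity_eq_sum (hb : IsRadialProfile b R) (hu : MemLp u 2)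
    (hg : ∀ j, MemLp (g j) 2) :
    ∫ x, kineticDensity (radialField b) u g x =
      ∑ j, ∫ x, ‖magneticGradient (radialField b) u g j x‖ ^ 2 :=
  integral_finsetSum _ fun j _ =>
    (hb.memLp_magneticGradient hu hg j).integrable_norm_pow two_ne_zero

lemma eLpNorm_magneticGradient_le (hb : IsRadialProfile b R) (hu : AEStronglyMeasurable u)
    (hg : ∀ j, AEStronglyMeasurable (g j)) (j : Fin 2) :
    eLpNorm (magneticGradient (radialField b) u g j) 2 volume ≤
      eLpNorm (g j) 2 volume + ENNReal.ofReal (potentialBound b) * eLpNorm u 2 volume := by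
  have hA : AEStronglyMeasurable fun x => (vectorPotential (radialField b) x j : ℂ) :=
    (Complex.measurable_ofReal.comp (hb.measurable_vectorPotential j)).aestronglyMeasurable
  refine (eLpNorm_add_le ((hg j).const_mul Complex.I) (hA.mul hu) one_le_two).trans
    (add_le_add (eLpNorm_mono fun x => ?_)
      (eLpNorm_le_mul_eLpNorm_of_ae_le_mul (.of_forall fun x => ?_) 2))
  · rw [norm_mul, Complex.norm_I, one_mul]
  · rw [Pi.mul_apply, norm_mul, Complex.norm_real]
    exact mul_le_mul_of_nonneg_right (hb.abs_vectorPotential_le x j) (norm_nonneg _)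

lemma tendsto_integral_kineticDensity (hb : IsRadialProfile b R) (hu : MemLp u 2)
    (hg : ∀ j, MemLp (g j) 2) (hφ : ∀ n, MemLp (φ n) 2) (hγ : ∀ n j, MemLp (γ n j) 2)
    (hφu : Tendsto (fun n => eLpNorm (φ n - u) 2 volume) atTop (𝓝 0))
    (hγg : ∀ j, Tendsto (fun n => eLpNorm (γ n j - g j) 2 volume) atTop (𝓝 0)) :
    Tendsto (fun n => ∫ x, kineticDensity (radialField b) (φ n) (γ n) x) atTop
      (𝓝 (∫ x, kineticDensity (radialField b) u g x)) := by
  simp only [hb.integral_kineticDensity_eq_sum hu hg,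
    hb.integral_kineticDensity_eq_sum (hφ _) (hγ _)]
  refine tendsto_finsetSum _ fun j _ => tendsto_integral_norm_sq
    (fun n => hb.memLp_magneticGradient (hφ n) (hγ n) j) (hb.memLp_magneticGradient hu hg j) ?_
  have hlim := (hγg j).add (ENNReal.Tendsto.const_mul hφu
    (.inr (ENNReal.ofReal_ne_top (r := potentialBound b))))
  rw [mul_zero, add_zero] at hlim
  refine tendsto_of_tendsto_of_tendsto_of_le_of_le tendsto_const_nhds hlim (fun _ => zero_le)
    fun n => ?_
  rw [← magneticGradient_sub]
  exact hb.eLpNorm_magneticGradient_le ((hφ n).sub hu).1 (fun j => ((hγ n j).sub (hg j)).1) j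

theorem hardy_of_hasL2WeakGradient (hb : IsRadialProfile b R) (hu : MemLp u 2)
    (hg : HasL2WeakGradient u g) :
    zeroModeWeight b R * distInt (flux (radialField b)) ^ 2 *
        ∫ x, ‖u x‖ ^ 2 / (R ^ 2 + ‖x‖ ^ 2) ≤
      (∫ x, kineticDensity (radialField b) u g x) + ∫ x, radialField b x * ‖u x‖ ^ 2 := by
  obtain ⟨φ, hφ, hφs, hφu, hφg⟩ := exists_contDiff_tendsto hu hg
  have hφ2 (n : ℕ) : MemLp (φ n) 2 := (hφ n).continuous.memLp_of_hasCompactSupport (hφs n)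
  have hφ1 (n : ℕ) : ContDiff ℝ 1 (φ n) := (hφ n).of_le (by simp)
  have hγ (n : ℕ) : HasL2WeakGradient (φ n) (classicalGradient (φ n)) :=
    ⟨memLp_classicalGradient (hφ1 n) (hφs n), hasWeakGradient_classicalGradient (hφ1 n)⟩
  exact le_of_tendsto_of_tendsto' ((tendsto_integral_hardyWeight hb.pos hu hφ2 hφu).const_mul _)
    ((hb.tendsto_integral_kineticDensity hu hg.1 hφ2 (fun n => (hγ n).1) hφu hφg).add
      (hb.tendsto_integral_radialField_mul_norm_sq hu hg hφ2 hγ hφu hφg))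
    fun n => hb.hardy_of_contDiff (contDiff_infty.1 (hφ n) 2) (hφs n)

end Limits

end IsRadialProfile

lemma MemLpLocRadial.exists_measurable {b : ℝ → ℝ} {p : ℝ≥0∞} {R : ℝ} (hb : MemLpLocRadial b p)
    (hp : 2 ≤ p) (hR : 0 < R) : ∃ f, Measurable f ∧ (∀ᵐ r : ℝ, r ∈ Ioc 0 R → b r = f r) ∧
      IntegrableOn (fun r => f r ^ 2 * r) (Ioc 0 R) := by
  let ν := (volume.restrict (Ioc 0 R)).withDensity fun r : ℝ => ENNReal.ofReal r
  have hfin : IsFiniteMeasure ν := isFiniteMeasure_withDensity_ofReal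
    ((continuous_id.integrableOn_Icc (a := 0) (b := R)).mono_set Ioc_subset_Icc_self).2
  have hb2 : MemLp b 2 ν := (hb R hR).mono_exponent hp
  have hac : volume.restrict (Ioc 0 R) ≪ ν := by
    refine withDensity_absolutelyContinuous' ENNReal.measurable_ofReal.aemeasurable ?_
    filter_upwards [ae_restrict_mem measurableSet_Ioc] with r hr
    exact (ENNReal.ofReal_pos.2 hr.1).ne'
  obtain ⟨f, hf, hbf⟩ : ∃ f, Measurable f ∧ b =ᵐ[ν] f :=
    ⟨_, hb2.1.stronglyMeasurable_mk.measurable, hb2.1.ae_eq_mk⟩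
  refine ⟨f, hf, (ae_restrict_iff' measurableSet_Ioc).1 (hac.ae_le hbf), ?_⟩
  have hsq := (integrable_withDensity_iff_integrable_smul' ENNReal.measurable_ofReal
    (.of_forall fun _ => ENNReal.ofReal_lt_top)).1 (hb2.ae_eq hbf).integrable_sq
  refine IntegrableOn.congr_fun hsq (fun r hr => ?_) measurableSet_Ioc
  simp only [smul_eq_mul, ENNReal.toReal_ofReal hr.1.le, mul_comm r]

lemma exists_isRadialProfile {b : ℝ → ℝ} {p : ℝ≥0∞} {R : ℝ} (hp : 2 ≤ p) (hR : 0 < R)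
    (hb : MemLpLocRadial b p) (hb_nonneg : ∀ᵐ r : ℝ, 0 < r → 0 ≤ b r)
    (hb_supp : ∀ᵐ r : ℝ, R ≤ r → b r = 0) :
    ∃ b', IsRadialProfile b' R ∧ ∀ᵐ r : ℝ, 0 < r → b r = b' r := by
  obtain ⟨f, hf, hbf, hf_sq⟩ := hb.exists_measurable hp hR
  refine ⟨(Ioo 0 R).indicator fun r => |f r|, ⟨hR, hf.abs.indicator measurableSet_Ioo,
    fun r => indicator_nonneg (fun _ _ => abs_nonneg _) r,
    fun r hr => indicator_of_notMem hr _, ?_⟩, ?_⟩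
  · refine ((integrable_indicator_iff measurableSet_Ioo).2
      (hf_sq.mono_set Ioo_subset_Ioc_self)).congr (.of_forall fun r => ?_)
    by_cases hr : r ∈ Ioo 0 R
    · simp only [indicator_of_mem hr, sq_abs]
    · simp only [indicator_of_notMem hr, ne_eq, OfNat.ofNat_ne_zero, not_false_eq_true, zero_pow,
        zero_mul]
  · filter_upwards [hbf, hb_nonneg, hb_supp] with r hbf_r hnonneg hsupp h0
    rcases lt_or_ge r R with hr | hr
    · rw [indicator_of_mem (show r ∈ Ioo 0 R from ⟨h0, hr⟩), ← hbf_r ⟨h0, hr.le⟩,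
        abs_of_nonneg (hnonneg h0)]
    · rw [indicator_of_notMem (fun h => h.2.not_ge hr), hsupp hr]

section Congr

variable {B B' : Plane → ℝ}

lemma scalarPotential_congr (h : B =ᵐ[volume] B') : scalarPotential B = scalarPotential B' :=
  funext fun x => congrArg (-(1 / (2 * π)) * ·)
    (integral_congr_ae (h.mono fun y hy => by simp only [hy]))

lemma flux_congr (h : B =ᵐ[volume] B') : flux B = flux B' := by
  rw [flux, flux, integral_congr_ae h]

lemma betaPlus_congr (h : B =ᵐ[volume] B') (ρ : ℝ) : betaPlus B ρ = betaPlus B' ρ := by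
  simp only [betaPlus, kPlus, capKPlus, scalarPotential_congr h, flux_congr h]

lemma pauliDensity_congr (h : B =ᵐ[volume] B') (u : Plane → ℂ) :
    pauliDensity B u =ᵐ[volume] pauliDensity B' u := by
  filter_upwards [h] with x hx
  simp only [pauliDensity, vectorPotential, scalarPotential_congr h, hx]

lemma logMoment_congr {b b' : ℝ → ℝ} {R : ℝ} (hR : 0 ≤ R)
    (h : ∀ᵐ r : ℝ, 0 < r → b r = b' r) : logMoment b R = logMoment b' R := by
  refine intervalIntegral.integral_congr_ae (h.mono fun r hr hr' => ?_)
  rw [uIoc_of_le hR] at hr'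
  rw [hr hr'.1]

end Congr

lemma MemH1.hasL2WeakGradient {u : Plane → ℂ} (hu : MemH1 u) :
    HasL2WeakGradient u (weakGradient u) := by
  rw [weakGradient, dif_pos hu.2]
  exact hu.2.choose_spec

namespace IsRadialProfile

variable {b : ℝ → ℝ} {R : ℝ} {u : Plane → ℂ}

lemma integrable_pauliDensity (hb : IsRadialProfile b R) (hu : MemH1 u) :
    Integrable (pauliDensity (radialField b) u) :=
  (hb.integrable_kineticDensity hu.1 hu.hasL2WeakGradient.1).add
    (hb.integrable_radialField_mul_norm_sq_of_hasL2WeakGradient hu.1 hu.hasL2WeakGradient)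

theorem hardy_pauliForm (hb : IsRadialProfile b R) (hu : MemH1 u) :
    distInt (flux (radialField b)) ^ 2 *
        (Real.exp (2 * logMoment b R) / R ^ (2 * flux (radialField b))) *
        ∫ x, ‖u x‖ ^ 2 / (R ^ 2 + ‖x‖ ^ 2) ≤ pauliForm (radialField b) u := by
  have hg := hu.hasL2WeakGradient
  have hform : pauliForm (radialField b) u =
      (∫ x, kineticDensity (radialField b) u (weakGradient u) x) +
        ∫ x, radialField b x * ‖u x‖ ^ 2 :=
    integral_add (hb.integrable_kineticDensity hu.1 hg.1)
      (hb.integrable_radialField_mul_norm_sq_of_hasL2WeakGradient hu.1 hg)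
  rw [hform, ← hb.zeroModeWeight_self, mul_comm (_ ^ 2)]
  exact hb.hardy_of_hasL2WeakGradient hu.1 hg

end IsRadialProfile

end PauliHardy

theorem proposition2p8_general (b : ℝ → ℝ) (p : ℝ≥0∞) (R : ℝ) (hp : 2 ≤ p) (hR : 0 < R)
    (hb : PauliHardy.MemLpLocRadial b p)
    (hb_nonneg : ∀ᵐ r : ℝ, 0 < r → 0 ≤ b r)
    (hb_supp : ∀ᵐ r : ℝ, R ≤ r → b r = 0) :
    Differentiable ℝ (PauliHardy.scalarPotential (PauliHardy.radialField b)) ∧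
    PauliHardy.betaPlus (PauliHardy.radialField b) R =
      Real.exp (2 * PauliHardy.logMoment b R) /
        R ^ (2 * PauliHardy.flux (PauliHardy.radialField b)) ∧
    ∀ u : PauliHardy.Plane → ℂ, PauliHardy.MemH1 u →
      Integrable (PauliHardy.pauliDensity (PauliHardy.radialField b) u) ∧
      PauliHardy.distInt (PauliHardy.flux (PauliHardy.radialField b)) ^ 2 *
          (Real.exp (2 * PauliHardy.logMoment b R) /
            R ^ (2 * PauliHardy.flux (PauliHardy.radialField b))) *
          (∫ x, ‖u x‖ ^ 2 / (R ^ 2 + ‖x‖ ^ 2)) ≤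
        PauliHardy.pauliForm (PauliHardy.radialField b) u := by
  obtain ⟨b', hb', hbb'⟩ := PauliHardy.exists_isRadialProfile hp hR hb hb_nonneg hb_supp
  have hB : PauliHardy.radialField b =ᵐ[volume] PauliHardy.radialField b' :=
    PauliHardy.ae_norm_of_ae_pos volume hbb'
  have hdensity (u : PauliHardy.Plane → ℂ) := PauliHardy.pauliDensity_congr hB u
  rw [PauliHardy.scalarPotential_congr hB, PauliHardy.betaPlus_congr hB,
    PauliHardy.flux_congr hB, PauliHardy.logMoment_congr hR.le hbb']
  refine ⟨fun x => (hb'.hasFDerivAt_scalarPotential x).differentiableAt,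
    hb'.betaPlus_radialField, fun u hu => ⟨(hb'.integrable_pauliDensity hu).congr
      (hdensity u).symm, (hb'.hardy_pauliForm hu).trans_eq ?_⟩⟩
  exact (integral_congr_ae (hdensity u)).symm

theorem proposition2p8 (b : ℝ → ℝ) (p : ℝ≥0∞) (R : ℝ) (hp : 2 < p) (hR : 0 < R)
    (hb : PauliHardy.MemLpLocRadial b p)
    (hb_nonneg : ∀ᵐ r : ℝ, 0 < r → 0 ≤ b r)
    (hb_supp : ∀ᵐ r : ℝ, R ≤ r → b r = 0)
    (hflux : 0 < ∫ x, PauliHardy.radialField b x) :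
    Differentiable ℝ (PauliHardy.scalarPotential (PauliHardy.radialField b)) ∧
    PauliHardy.betaPlus (PauliHardy.radialField b) R =
      Real.exp (2 * PauliHardy.logMoment b R) /
        R ^ (2 * PauliHardy.flux (PauliHardy.radialField b)) ∧
    ∀ u : PauliHardy.Plane → ℂ, PauliHardy.MemH1 u →
      Integrable (PauliHardy.pauliDensity (PauliHardy.radialField b) u) ∧
      PauliHardy.distInt (PauliHardy.flux (PauliHardy.radialField b)) ^ 2 *
          (Real.exp (2 * PauliHardy.logMoment b R) /
            R ^ (2 * PauliHardy.flux (PauliHardy.radialField b))) *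
          (∫ x, ‖u x‖ ^ 2 / (R ^ 2 + ‖x‖ ^ 2)) ≤
        PauliHardy.pauliForm (PauliHardy.radialField b) u :=
  proposition2p8_general b p R hp.le hR hb hb_nonneg hb_supp
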